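/- **Model.** Fix lengths $0<\ell_{\min}<\ell_{\max}$ and put $\rho=\ell_{\max}/\ell_{\min}$, $\overline\gamma=\lfloor\rho\rfloor$. Packets arrive at a sender according to a Poisson process of rate $\lambda>0$; each packet independently has length $\ell_{\min}$ with probability $p>0$ and $\ell_{\max}$ with probability $q>0$, where $p+q=1$. Transmitting a packet of length $\ell$ takes time $\ell$. An error event strictly inside a transmission interval corrupts the packet, which then has to be retransmitted in full; the sender learns of the error instantaneously and is free again at that moment. A (deterministic, online, work-conserving) algorithm $\mathrm{Alg}$ starts transmitting some pending packet whenever the link is free and packets are pending, chooses it knowing only the arrivals and error events up to the current time, and does not abort a transmission unless an error occurs. An adversarial error function $E$ (it may depend on $\mathrm{Alg}$) assigns to every arrival pattern $A$ a locally finite set of error times, such that the errors up to time $t$ depend only on the arrivals up to time $t$. For an arrival pattern $A$ let $L_{\mathrm{Alg}}(A,E,t)$ be the total length of the packets that $\mathrm{Alg}$ has transmitted successfully by time $t$, and let $L_{\mathrm{OPT}}(A,E,t)$ be the supremum of the total length that an offline schedule, knowing $A$ and all the errors, transmits successfully by time $t$. Non-trivial communication is required: $L_{\mathrm{OPT}}(A,E,t)$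 is unbounded in $t$ for every pattern $A$ with infinitely many packets of each length. Let $\mathcal E$ be the set of all such $E$. Put $T_{\mathrm{Alg}}(A,E,t)=L_{\mathrm{Alg}}(A,E,t)/L_{\mathrm{OPT}}(A,E,t)$, and $T_{\mathrm{Alg}}(A,E,t)=1$ if both lengths are $0$. The relative throughput of $\mathrm{Alg}$ is $$T_{\mathrm{Alg}}=\inf_{E\in\mathcal E}\ \limsup_{t\to\infty}\ \mathbb E_A\bigl[T_{\mathrm{Alg}}(A,E,t)\bigr]$$ (where $\mathbb E$ is the upper expectation if the random variable is not measurable). **Theorem.** Let $p<q$. Then every algorithm $\mathrm{Alg}$ satisfies $$T_{\mathrm{Alg}}\le\min\left\{\max\left\{\lambda p\,\ell_{\min},\ \frac{\overline\gamma}{\rho+\overline\gamma}\right\},\ \frac{\overline\gamma}{\rho}\right\}.$$ -/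

import Mathlib

open MeasureTheory ProbabilityTheory Filter
open scoped ENNReal

noncomputable section

namespace PacketScheduling

/-- An arrival pattern: packet `n` (`n = 0, 1, 2, …`) arrives at time `time n` and has one of two
lengths; it is short when `isShort n = true` and long otherwise. -/
structure ArrivalPattern where
  time : ℕ → ℝ
  isShort : ℕ → Bool
  time_pos : ∀ n, 0 < time n
  time_strictMono : StrictMono time
  time_unbounded : Tendsto time atTop atTop

namespace ArrivalPattern

/-- The length of packet `n`; it is also its transmission time. -/
def length (lmin lmax : ℝ) (A : ArrivalPattern) (n : ℕ) : ℝ :=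
  if A.isShort n = true then lmin else lmax

/-- The time between arrival `n - 1` (time `0` if `n = 0`) and arrival `n`. -/
def gap (A : ArrivalPattern) : ℕ → ℝ
  | 0 => A.time 0
  | n + 1 => A.time (n + 1) - A.time n

/-- The packets that have arrived by time `t` and are not among the delivered packets `D`. -/
def pending (A : ArrivalPattern) (t : ℝ) (D : Finset ℕ) : Set ℕ :=
  {i | A.time i ≤ t ∧ i ∉ D}

/-- The two patterns have the same packet arrivals in `[0, t]`. -/
def AgreeUpTo (A A' : ArrivalPattern) (t : ℝ) : Prop :=
  ∀ n, A.time n ≤ t ∨ A'.time n ≤ t → A.time n = A'.time n ∧ A.isShort n = A'.isShort n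

/-- Infinitely many packets of each of the two lengths arrive. -/
def Recurrent (A : ArrivalPattern) : Prop :=
  ∀ b : Bool, {n | A.isShort n = b}.Infinite

end ArrivalPattern

/-- A deterministic online work-conserving scheduling algorithm with instantaneous feedback.
Whenever the link is free at a time `t` and packets are pending, it chooses a pending packet,
knowing the arrivals up to time `t`, the error events up to time `t`, and the set `D` of packets
that it has delivered so far (its own past decisions are determined by this information). -/
structure OnlineAlgorithm where
  choose : ArrivalPattern → Set ℝ → ℝ → Finset ℕ → ℕ
  choose_mem : ∀ A E t D, (A.pending t D).Nonempty → choose A E t D ∈ A.pending t D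
  choose_causal : ∀ A A' E E' t D, A.AgreeUpTo A' t → E ∩ Set.Iic t = E' ∩ Set.Iic t →
    choose A E t D = choose A' E' t D

open Classical in
/-- One step of the execution under the arrival pattern `A` and the set `E` of error times. A state
`(t, D)` consists of a time `t` at which the link is free and the set `D` of packets delivered by
time `t`. If nothing is pending, the sender waits for the next arrival. Otherwise it transmits
the chosen packet; if an error occurs strictly during the transmission, the packet is corrupted
and the link is free again at the moment of the first such error; else the packet is
delivered when its transmission ends. -/
def OnlineAlgorithm.step (alg : OnlineAlgorithm) (lmin lmax : ℝ) (A : ArrivalPattern) (E : Set ℝ)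
    (x : ℝ × Finset ℕ) : ℝ × Finset ℕ :=
  let i := alg.choose A E x.1 x.2
  if (A.pending x.1 x.2).Nonempty then
    if ∃ e ∈ E, x.1 < e ∧ e < x.1 + A.length lmin lmax i then
      (sInf (E ∩ Set.Ioi x.1), x.2)
    else
      (x.1 + A.length lmin lmax i, insert i x.2)
  else
    (sInf (Set.range A.time ∩ Set.Ioi x.1), x.2)

/-- The successive states of the execution, started at time `0` with nothing delivered. -/
def OnlineAlgorithm.state (alg : OnlineAlgorithm) (lmin lmax : ℝ) (A : ArrivalPattern)
    (E : Set ℝ) : ℕ → ℝ × Finset ℕ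
  | 0 => (0, ∅)
  | n + 1 => alg.step lmin lmax A E (alg.state lmin lmax A E n)

/-- The total length of the packets that the algorithm has delivered by time `t`. The sets of
delivered packets increase along the execution, so the supremum picks the last state up to `t`. -/
def OnlineAlgorithm.delivered (alg : OnlineAlgorithm) (lmin lmax : ℝ) (A : ArrivalPattern)
    (E : Set ℝ) (t : ℝ) : ℝ≥0∞ :=
  ⨆ (n : ℕ) (_ : (alg.state lmin lmax A E n).1 ≤ t),
    ENNReal.ofReal (∑ i ∈ (alg.state lmin lmax A E n).2, A.length lmin lmax i)

/-- A finite set of pairs (packet, starting time of its transmission) describes the successful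
transmissions of some offline schedule up to time `t`. -/
structure IsOfflineSchedule (lmin lmax : ℝ) (A : ArrivalPattern) (E : Set ℝ) (t : ℝ)
    (S : Finset (ℕ × ℝ)) : Prop where
  arrived : ∀ x ∈ S, A.time x.1 ≤ x.2
  completed : ∀ x ∈ S, x.2 + A.length lmin lmax x.1 ≤ t
  uncorrupted : ∀ x ∈ S, ∀ e ∈ E, ¬ (x.2 < e ∧ e < x.2 + A.length lmin lmax x.1)
  once : ∀ x ∈ S, ∀ y ∈ S, x ≠ y → x.1 ≠ y.1
  nonoverlapping : ∀ x ∈ S, ∀ y ∈ S, x ≠ y →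
    x.2 + A.length lmin lmax x.1 ≤ y.2 ∨ y.2 + A.length lmin lmax y.1 ≤ x.2

/-- The largest total length that an offline schedule, knowing all arrivals and errors, delivers
by time `t`. -/
def optDelivered (lmin lmax : ℝ) (A : ArrivalPattern) (E : Set ℝ) (t : ℝ) : ℝ≥0∞ :=
  ⨆ (S : Finset (ℕ × ℝ)) (_ : IsOfflineSchedule lmin lmax A E t S),
    ENNReal.ofReal (∑ x ∈ S, A.length lmin lmax x.1)

open Classical in
/-- The relative throughput by time `t` under fixed arrivals and errors. -/
def throughputAt (alg : OnlineAlgorithm) (lmin lmax : ℝ) (A : ArrivalPattern) (E : Set ℝ)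
    (t : ℝ) : ℝ≥0∞ :=
  if alg.delivered lmin lmax A E t = 0 ∧ optDelivered lmin lmax A E t = 0 then 1
  else alg.delivered lmin lmax A E t / optDelivered lmin lmax A E t

/-- An adaptive adversarial error function for stochastic arrivals: the error events up to time `t`
depend only on the arrivals up to time `t`, only finitely many errors occur in bounded
time, and non-trivial communication is possible, that is, the optimal offline
throughput is unbounded. Which patterns lead to which errors may depend in any way
on the algorithm that the adversary plays against. -/
structure ErrorFunction (lmin lmax : ℝ) where
  errors : ArrivalPattern → Set ℝ
  nonneg : ∀ A, ∀ e ∈ errors A, 0 ≤ e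
  locallyFinite : ∀ A t, (errors A ∩ Set.Iic t).Finite
  causal : ∀ A A' t, A.AgreeUpTo A' t → errors A ∩ Set.Iic t = errors A' ∩ Set.Iic t
  nontrivial : ∀ A : ArrivalPattern, A.Recurrent → ∀ M : ℝ, ∃ t : ℝ,
    ENNReal.ofReal M ≤ optDelivered lmin lmax A (errors A) t

variable {Ω : Type*} [MeasurableSpace Ω]

/-- Packets arrive according to a Poisson process of rate `lam` (the interarrival times are
independent and exponential) and are independently short with probability `p`. -/
structure IsPoissonArrivals (μ : Measure Ω) (lam p : ℝ) (A : Ω → ArrivalPattern) : Prop where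
  measurable_gap : ∀ n, Measurable fun ω => (A ω).gap n
  measurable_isShort : ∀ n, Measurable fun ω => (A ω).isShort n
  gap_law : ∀ n, μ.map (fun ω => (A ω).gap n) = expMeasure lam
  short_prob : ∀ n, μ {ω | (A ω).isShort n = true} = ENNReal.ofReal p
  indep_gap_isShort : ∀ n, IndepFun (fun ω => (A ω).gap n) (fun ω => (A ω).isShort n) μ
  indep : iIndepFun (fun n ω => ((A ω).gap n, (A ω).isShort n)) μ

/-- The upper expectation: the infimum of the expectations of the measurable functions above `f`.
It is the expectation of `f` when `f` is measurable, and it makes sense without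
measurability assumptions on algorithms and adversaries. -/
def upperExpectation (μ : Measure Ω) (f : Ω → ℝ≥0∞) : ℝ≥0∞ :=
  ⨅ (g : Ω → ℝ≥0∞) (_ : Measurable g) (_ : ∀ ω, f ω ≤ g ω), ∫⁻ ω, g ω ∂μ

theorem upperExpectation_eq_lintegral (μ : Measure Ω) (f : Ω → ℝ≥0∞) (hf : Measurable f) :
    upperExpectation μ f = ∫⁻ ω, f ω ∂μ :=
  le_antisymm (iInf_le_of_le f (iInf_le_of_le hf (iInf_le _ fun _ => le_rfl)))
    (le_iInf fun _ => le_iInf fun _ => le_iInf fun h => lintegral_mono h)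

/-- The relative throughput of an algorithm under stochastic arrivals: the infimum over the
adversarial error functions of the long-run expected relative throughput. The upper limit
is used, since the limit need not exist. -/
def relativeThroughput (lmin lmax : ℝ) (μ : Measure Ω) (A : Ω → ArrivalPattern)
    (alg : OnlineAlgorithm) : ℝ≥0∞ :=
  ⨅ F : ErrorFunction lmin lmax,
    limsup (fun t : ℝ => upperExpectation μ
      fun ω => throughputAt alg lmin lmax (A ω) (F.errors (A ω)) t) atTop

end PacketScheduling

end

/-! The adversary looks at what the algorithm starts. If it is a short packet, the next error comes
after time `lmax`: an offline schedule delivers one long packet, while the algorithm delivers at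
least one and at most `⌊lmax / lmin⌋₊` short ones. Otherwise the next error comes after `lmin`: the
offline schedule delivers a short packet and the algorithm nothing. So the algorithm never delivers
a long packet, and its total is always at most `γ / ρ` times that of the offline schedule
(`exists_adversaryInvariant`).

The offline schedule has used at most as many long packets as the algorithm has delivered short
ones. Since `p < q`, after some time it can therefore only run out of short packets. If it does, it
has delivered every short packet that has arrived, and the ratio is at most `γ / (ρ + γ)`; jamming
the link then freezes this ratio. If it does not, it is busy all the time, while the algorithm is
limited to the short packets that arrive, which gives `lam * p * lmin` asymptotically
(`exists_ratioLE`).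

Communication may not stop forever, so play must resume, and while it is going on the last bound is
not yet available. Hence the adversary plays only in windows `[n!, n * n!)`, long enough to make
their past negligible, and jams the link elsewhere by errors at distance `lmin / 2`. The active
windows are random, one `n` in each block `[k², k² + k]`, picked by a uniform variable extracted
from the first arrival time, so that the adversary stays deterministic and causal. Every pattern has
infinitely many active windows, but a fixed time meets one with vanishing probability, so the
expectation is small at all late times (`limsup_upperExpectation_le`). -/

namespace PacketScheduling

/-! ### Arrival patterns, locally finite sets of times, offline schedules. -/

namespace ArrivalPattern

theorem AgreeUpTo.symm {A A' : ArrivalPattern} {t : ℝ} (h : A.AgreeUpTo A' t) :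
    A'.AgreeUpTo A t := fun n hn =>
  ⟨(h n hn.symm).1.symm, (h n hn.symm).2.symm⟩

theorem AgreeUpTo.mono {A A' : ArrivalPattern} {s t : ℝ} (h : A.AgreeUpTo A' t) (hst : s ≤ t) :
    A.AgreeUpTo A' s := fun n hn => h n (hn.imp (·.trans hst) (·.trans hst))

theorem AgreeUpTo.time_le_iff {A A' : ArrivalPattern} {t : ℝ} (h : A.AgreeUpTo A' t) (n : ℕ) :
    A.time n ≤ t ↔ A'.time n ≤ t :=
  ⟨fun hn => (h n (.inl hn)).1 ▸ hn, fun hn => (h n (.inr hn)).1 ▸ hn⟩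

theorem AgreeUpTo.pending_eq {A A' : ArrivalPattern} {t : ℝ} (h : A.AgreeUpTo A' t)
    (D : Finset ℕ) : A.pending t D = A'.pending t D := by
  ext i
  simp only [pending, Set.mem_ofPred_eq, h.time_le_iff i]

theorem AgreeUpTo.length_eq {A A' : ArrivalPattern} {t : ℝ} (h : A.AgreeUpTo A' t)
    (lmin lmax : ℝ) {i : ℕ} (hi : A.time i ≤ t) :
    A.length lmin lmax i = A'.length lmin lmax i := by
  simp only [length, (h i (.inl hi)).2]

theorem finite_time_le (A : ArrivalPattern) (t : ℝ) : {n | A.time n ≤ t}.Finite := by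
  obtain ⟨N, hN⟩ := (A.time_unbounded.eventually_gt_atTop t).exists_forall_of_atTop
  exact (Set.finite_lt_nat N).subset fun n hn => by
    by_contra h
    exact absurd (hN n (not_lt.1 h)) (not_lt.2 hn)

variable {lmin lmax : ℝ}

theorem length_of_isShort {A : ArrivalPattern} {n : ℕ} (h : A.isShort n = true) :
    A.length lmin lmax n = lmin := if_pos h

theorem length_of_not_isShort {A : ArrivalPattern} {n : ℕ} (h : A.isShort n = false) :
    A.length lmin lmax n = lmax := by simp [length, h]

theorem le_length (hl : lmin ≤ lmax) (A : ArrivalPattern) (n : ℕ) :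
    lmin ≤ A.length lmin lmax n := by
  unfold length; split_ifs <;> simp [hl]

theorem isShort_of_length_lt {A : ArrivalPattern} {n : ℕ} (h : A.length lmin lmax n < lmax) :
    A.isShort n = true := by
  by_contra hn
  rw [length_of_not_isShort (by simpa using hn)] at h
  exact h.false

end ArrivalPattern

/-- Only finitely many points of the set lie below any given time. -/
def FiniteBelow (E : Set ℝ) : Prop := ∀ t, (E ∩ Set.Iic t).Finite

theorem FiniteBelow.exists_isLeast {E : Set ℝ} (hE : FiniteBelow E) {t : ℝ}
    (h : (E ∩ Set.Ioi t).Nonempty) : ∃ m, IsLeast (E ∩ Set.Ioi t) m := by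
  obtain ⟨e, he, hte⟩ := h
  have hfin : ((E ∩ Set.Iic e) ∩ Set.Ioi t).Finite := (hE e).inter_of_left _
  obtain ⟨m, ⟨⟨hm1, hm2⟩, hm3⟩, hmin⟩ :=
    Set.exists_min_image _ id hfin ⟨e, ⟨he, le_refl e⟩, hte⟩
  refine ⟨m, ⟨hm1, hm3⟩, fun x hx => ?_⟩
  by_cases hxe : x ≤ e
  · exact hmin x ⟨⟨hx.1, hxe⟩, hx.2⟩
  · exact (Set.mem_Iic.1 hm2).trans (not_le.1 hxe).le

theorem ArrivalPattern.finiteBelow_range_time (A : ArrivalPattern) :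
    FiniteBelow (Set.range A.time) := fun t => by
  refine ((A.finite_time_le t).image A.time).subset ?_
  rintro _ ⟨⟨n, rfl⟩, hn⟩
  exact ⟨n, hn, rfl⟩

theorem ArrivalPattern.exists_isLeast_time (A : ArrivalPattern) (t : ℝ) :
    ∃ m, IsLeast (Set.range A.time ∩ Set.Ioi t) m := by
  obtain ⟨n, hn⟩ := (A.time_unbounded.eventually_gt_atTop t).exists
  exact A.finiteBelow_range_time.exists_isLeast ⟨_, ⟨n, rfl⟩, hn⟩

theorem IsOfflineSchedule.insert_transmission {lmin lmax : ℝ} {A : ArrivalPattern} {E : Set ℝ}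
    {s t t' : ℝ}
    {S : Finset (ℕ × ℝ)} (hS : IsOfflineSchedule lmin lmax A E s S) {i : ℕ}
    (hst : s ≤ t) (hi : A.time i ≤ t)
    (hlen : t + A.length lmin lmax i ≤ t') (hst' : s ≤ t')
    (hE : ∀ e ∈ E, ¬ (t < e ∧ e < t + A.length lmin lmax i)) (hnew : ∀ x ∈ S, x.1 ≠ i) :
    IsOfflineSchedule lmin lmax A E t' (insert (i, t) S) where
  arrived := by
    simp only [Finset.forall_mem_insert]
    exact ⟨hi, hS.arrived⟩
  completed := by
    simp only [Finset.forall_mem_insert]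
    exact ⟨hlen, fun x hx => (hS.completed x hx).trans hst'⟩
  uncorrupted := by
    simp only [Finset.forall_mem_insert]
    exact ⟨hE, hS.uncorrupted⟩
  once := by
    simp only [Finset.forall_mem_insert]
    exact ⟨⟨fun h => absurd rfl h, fun x hx _ => (hnew x hx).symm⟩,
      fun x hx => ⟨fun _ => hnew x hx, hS.once x hx⟩⟩
  nonoverlapping := by
    simp only [Finset.forall_mem_insert]
    exact ⟨⟨fun h => absurd rfl h, fun x hx _ => .inr ((hS.completed x hx).trans hst)⟩,
      fun x hx => ⟨fun _ => .inl ((hS.completed x hx).trans hst), hS.nonoverlapping x hx⟩⟩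

theorem IsOfflineSchedule.mono {lmin lmax : ℝ} {A : ArrivalPattern} {E : Set ℝ} {s t : ℝ}
    {S : Finset (ℕ × ℝ)} (hS : IsOfflineSchedule lmin lmax A E s S) (hst : s ≤ t) :
    IsOfflineSchedule lmin lmax A E t S :=
  ⟨hS.1, fun x hx => (hS.2 x hx).trans hst, hS.3, hS.4, hS.5⟩

theorem IsOfflineSchedule.le_optDelivered {lmin lmax : ℝ} {A : ArrivalPattern} {E : Set ℝ}
    {t : ℝ} {S : Finset (ℕ × ℝ)} (hS : IsOfflineSchedule lmin lmax A E t S) :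
    ENNReal.ofReal (∑ x ∈ S, A.length lmin lmax x.1) ≤ optDelivered lmin lmax A E t :=
  le_iSup₂_of_le S hS le_rfl

/-! ### Executions of an online algorithm: causality and comparison with offline schedules. -/

namespace OnlineAlgorithm

variable {alg : OnlineAlgorithm} {lmin lmax : ℝ} {A A' : ArrivalPattern} {E E' : Set ℝ}
  {t T : ℝ} {D : Finset ℕ}

theorem step_idle (h : ¬ (A.pending t D).Nonempty) {m : ℝ}
    (hm : IsLeast (Set.range A.time ∩ Set.Ioi t) m) :
    alg.step lmin lmax A E (t, D) = (m, D) := by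
  simp only [step, h, if_false, hm.csInf_eq]

theorem step_corrupted (h : (A.pending t D).Nonempty) {e : ℝ} (he : IsLeast (E ∩ Set.Ioi t) e)
    (hlen : e < t + A.length lmin lmax (alg.choose A E t D)) :
    alg.step lmin lmax A E (t, D) = (e, D) := by
  have : ∃ e ∈ E, t < e ∧ e < t + A.length lmin lmax (alg.choose A E t D) :=
    ⟨e, he.1.1, he.1.2, hlen⟩
  simp only [step, h, if_true, this, he.csInf_eq]

theorem step_delivered (h : (A.pending t D).Nonempty)
    (hE : ∀ e ∈ E, t < e → t + A.length lmin lmax (alg.choose A E t D) ≤ e) :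
    alg.step lmin lmax A E (t, D) =
      (t + A.length lmin lmax (alg.choose A E t D), insert (alg.choose A E t D) D) := by
  have : ¬ ∃ e ∈ E, t < e ∧ e < t + A.length lmin lmax (alg.choose A E t D) := by
    rintro ⟨e, he, h1, h2⟩
    exact absurd (hE e he h1) (not_le.2 h2)
  simp only [step, h, if_true, this, if_false]

/-- The three kinds of steps of an execution. -/
theorem step_cases (hE : FiniteBelow E) (t : ℝ) (D : Finset ℕ) :
    (¬ (A.pending t D).Nonempty ∧ ∃ m, IsLeast (Set.range A.time ∩ Set.Ioi t) m ∧
      alg.step lmin lmax A E (t, D) = (m, D)) ∨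
    ((A.pending t D).Nonempty ∧ ∃ e, IsLeast (E ∩ Set.Ioi t) e ∧
      e < t + A.length lmin lmax (alg.choose A E t D) ∧
      alg.step lmin lmax A E (t, D) = (e, D)) ∨
    ((A.pending t D).Nonempty ∧
      (∀ e ∈ E, t < e → t + A.length lmin lmax (alg.choose A E t D) ≤ e) ∧
      alg.step lmin lmax A E (t, D) =
        (t + A.length lmin lmax (alg.choose A E t D), insert (alg.choose A E t D) D)) := by
  by_cases h : (A.pending t D).Nonempty
  · by_cases he : ∀ e ∈ E, t < e → t + A.length lmin lmax (alg.choose A E t D) ≤ e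
    · exact .inr (.inr ⟨h, he, step_delivered h he⟩)
    · push Not at he
      obtain ⟨e, he, hte, hlt⟩ := he
      obtain ⟨m, hm⟩ := hE.exists_isLeast ⟨e, he, hte⟩
      have hlt' := (hm.2 ⟨he, hte⟩).trans_lt hlt
      exact .inr (.inl ⟨h, m, hm, hlt', step_corrupted h hm hlt'⟩)
  · obtain ⟨m, hm⟩ := A.exists_isLeast_time t
    exact .inl ⟨h, m, hm, step_idle h hm⟩

theorem lt_step (hlmin : 0 < lmin) (hl : lmin ≤ lmax) (hE : FiniteBelow E) (x : ℝ × Finset ℕ) :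
    x.1 < (alg.step lmin lmax A E x).1 := by
  obtain ⟨t, D⟩ := x
  rcases step_cases (alg := alg) (lmin := lmin) (lmax := lmax) (A := A) hE t D with
    ⟨_, m, hm, h⟩ | ⟨_, e, he, _, h⟩ | ⟨_, _, h⟩ <;> rw [h]
  · exact hm.1.2
  · exact he.1.2
  · have := A.le_length hl (alg.choose A E t D)
    simp only
    linarith

theorem subset_step (hE : FiniteBelow E) (x : ℝ × Finset ℕ) :
    x.2 ⊆ (alg.step lmin lmax A E x).2 := by
  obtain ⟨t, D⟩ := x
  rcases step_cases (alg := alg) (lmin := lmin) (lmax := lmax) (A := A) hE t D with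
    ⟨_, m, hm, h⟩ | ⟨_, e, he, _, h⟩ | ⟨_, _, h⟩ <;> rw [h]
  exact Finset.subset_insert _ _

theorem strictMono_state (hlmin : 0 < lmin) (hl : lmin ≤ lmax) (hE : FiniteBelow E) :
    StrictMono fun n => (alg.state lmin lmax A E n).1 :=
  strictMono_nat_of_lt_succ fun _ => lt_step hlmin hl hE _

theorem monotone_state (hE : FiniteBelow E) :
    Monotone fun n => (alg.state lmin lmax A E n).2 :=
  monotone_nat_of_le_succ fun _ => subset_step hE _

/-- A step ending by `T` depends only on arrivals and errors up to `T`: the next arrival or error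
that ends it is common to both runs, and a delivery ending by `T` cannot be spoiled by an error
after `T`. -/
theorem step_causal (hlmin : 0 < lmin) (hl : lmin ≤ lmax) (hE : FiniteBelow E)
    (hA : A.AgreeUpTo A' T) (hEE : E ∩ Set.Iic T = E' ∩ Set.Iic T) (x : ℝ × Finset ℕ)
    (hx : (alg.step lmin lmax A E x).1 ≤ T) :
    alg.step lmin lmax A' E' x = alg.step lmin lmax A E x := by
  have hxT := (lt_step (alg := alg) (A := A) hlmin hl hE x).le.trans hx
  obtain ⟨t, D⟩ := x
  simp only at hxT
  have hAt := hA.mono hxT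
  have hEt : E ∩ Set.Iic t = E' ∩ Set.Iic t := by
    rw [← Set.inter_eq_self_of_subset_right (Set.Iic_subset_Iic.2 hxT), ← Set.inter_assoc, hEE,
      Set.inter_assoc]
  have hmem : ∀ e ≤ T, e ∈ E ↔ e ∈ E' := fun e he => by
    simpa [he] using Set.ext_iff.1 hEE e
  have hch := alg.choose_causal A A' E E' t D hAt hEt
  have hpend := hAt.pending_eq D
  rcases step_cases (alg := alg) (lmin := lmin) (lmax := lmax) (A := A) hE t D with
    ⟨hn, m, hm, h⟩ | ⟨hn, e, he, hlt, h⟩ | ⟨hn, hle, h⟩ <;> rw [h] at hx ⊢ <;> simp only at hx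
  · refine step_idle (hpend ▸ hn) ?_
    obtain ⟨⟨⟨n, rfl⟩, hn2⟩, hm2⟩ := hm
    refine ⟨⟨⟨n, (hA n (.inl hx)).1.symm⟩, hn2⟩, ?_⟩
    rintro _ ⟨⟨k, rfl⟩, hk⟩
    by_cases hkT : A'.time k ≤ T
    · exact hm2 ⟨⟨k, (hA k (.inr hkT)).1⟩, hk⟩
    · exact hx.trans (not_le.1 hkT).le
  · have hmemc := (alg.choose_mem A E t D hn).1
    rw [hAt.length_eq lmin lmax hmemc, hch] at hlt
    refine step_corrupted (hpend ▸ hn) ⟨⟨(hmem e hx).1 he.1.1, he.1.2⟩, fun e' he' => ?_⟩ hlt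
    by_cases hkT : e' ≤ T
    · exact he.2 ⟨(hmem e' hkT).2 he'.1, he'.2⟩
    · exact hx.trans (not_le.1 hkT).le
  · have hmemc := (alg.choose_mem A E t D hn).1
    rw [hAt.length_eq lmin lmax hmemc, hch] at hx hle ⊢
    refine step_delivered (hpend ▸ hn) fun e' he' hte => ?_
    by_cases hkT : e' ≤ T
    · exact hle e' ((hmem e' hkT).2 he') hte
    · exact hx.trans (not_le.1 hkT).le

theorem state_causal (hlmin : 0 < lmin) (hl : lmin ≤ lmax) (hE : FiniteBelow E)
    (hA : A.AgreeUpTo A' T) (hEE : E ∩ Set.Iic T = E' ∩ Set.Iic T) (n : ℕ)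
    (hx : (alg.state lmin lmax A E n).1 ≤ T) :
    alg.state lmin lmax A' E' n = alg.state lmin lmax A E n := by
  induction n with
  | zero => rfl
  | succ n ih =>
    have := ((strictMono_state (alg := alg) (A := A) hlmin hl hE).monotone n.le_succ).trans hx
    simp only [state] at hx ⊢
    rw [ih this]
    exact step_causal hlmin hl hE hA hEE _ hx

/-- The link is free at time `t`, with the packets in `D` delivered. -/
def Reaches (alg : OnlineAlgorithm) (lmin lmax : ℝ) (A : ArrivalPattern) (E : Set ℝ) (t : ℝ)
    (D : Finset ℕ) : Prop :=
  ∃ n, alg.state lmin lmax A E n = (t, D)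

theorem Reaches.causal (hlmin : 0 < lmin) (hl : lmin ≤ lmax) (hE : FiniteBelow E)
    (hA : A.AgreeUpTo A' t) (hEE : E ∩ Set.Iic t = E' ∩ Set.Iic t)
    (h : alg.Reaches lmin lmax A E t D) : alg.Reaches lmin lmax A' E' t D := by
  obtain ⟨n, hn⟩ := h
  exact ⟨n, (state_causal hlmin hl hE hA hEE n (by rw [hn])).trans hn⟩

theorem Reaches.unique (hlmin : 0 < lmin) (hl : lmin ≤ lmax) (hE : FiniteBelow E)
    {D' : Finset ℕ} (h : alg.Reaches lmin lmax A E t D) (h' : alg.Reaches lmin lmax A E t D') :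
    D = D' := by
  obtain ⟨n, hn⟩ := h
  obtain ⟨k, hk⟩ := h'
  have : n = k := (strictMono_state (alg := alg) (A := A) hlmin hl hE).injective (by simp [hn, hk])
  subst this
  exact (Prod.ext_iff.1 (hn.symm.trans hk)).2

theorem Reaches.step_eq {t' : ℝ} {D' : Finset ℕ} (h : alg.Reaches lmin lmax A E t D)
    (hs : alg.step lmin lmax A E (t, D) = (t', D')) : alg.Reaches lmin lmax A E t' D' := by
  obtain ⟨n, hn⟩ := h
  exact ⟨n + 1, by rw [state, hn, hs]⟩

theorem reaches_first_arrival : alg.Reaches lmin lmax A E (A.time 0) ∅ := by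
  refine Reaches.step_eq (t := 0) (D := ∅) ⟨0, rfl⟩ (step_idle ?_ ?_)
  · rintro ⟨i, hi, _⟩
    exact absurd (A.time_pos i) (not_lt.2 hi)
  · refine ⟨⟨⟨0, rfl⟩, A.time_pos 0⟩, ?_⟩
    rintro _ ⟨⟨n, rfl⟩, _⟩
    exact A.time_strictMono.monotone n.zero_le

/-- The algorithm is free at the next error event, if some packet that is too long to be
transmitted before it is pending. -/
theorem Reaches.next_error (hlmin : 0 < lmin) (hl : lmin ≤ lmax)
    (h : alg.Reaches lmin lmax A E t D) {e : ℝ} (he : e ∈ E) (hte : t ≤ e)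
    (hE : ∀ x ∈ E, t < x → e ≤ x) {i : ℕ} (hi : A.time i ≤ t) (hiD : i ∉ D)
    (hlen : e - t < A.length lmin lmax i) :
    ∃ D', alg.Reaches lmin lmax A E e D' ∧ D ⊆ D' ∧ lmin * D'.card ≤ lmin * D.card + (e - t) ∧
      ∀ j ∈ D', j ∉ D → A.length lmin lmax j ≤ e - t ∧ A.time j ≤ e := by
  -- Each delivery takes at least `lmin`, so `N` bounds the number of deliveries before `e`; the
  -- induction is on this bound.
  obtain ⟨N, hN⟩ := exists_nat_ge ((e - t) / lmin)
  induction N generalizing t D with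
  | zero =>
    have : e = t := by
      rw [div_le_iff₀ hlmin] at hN
      simp only [Nat.cast_zero, zero_mul] at hN
      linarith
    subst this
    exact ⟨D, h, subset_rfl, by simp, fun j hj hj' => absurd hj hj'⟩
  | succ N ih =>
    rcases hte.eq_or_lt with rfl | hlt
    · exact ⟨D, h, subset_rfl, by simp, fun j hj hj' => absurd hj hj'⟩
    have hp : (A.pending t D).Nonempty := ⟨i, hi, hiD⟩
    have hc := alg.choose_mem A E t D hp
    by_cases hle : t + A.length lmin lmax (alg.choose A E t D) ≤ e
    · have hstep := step_delivered (alg := alg) (lmin := lmin) (lmax := lmax) hp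
        fun x hx htx => hle.trans (hE x hx htx)
      have hlc := A.le_length hl (alg.choose A E t D)
      set c := alg.choose A E t D with hcdef
      -- The packet `i` does not fit before `e`, so it is not the one delivered; it stays pending
      -- and the link never idles before `e`.
      have hic : i ≠ c := by
        rintro rfl
        linarith
      obtain ⟨D', h1, h2, h3, h4⟩ := ih (h.step_eq hstep) hle
        (fun x hx htx => hE x hx (by linarith)) (by linarith)
        (by simp [hic, hiD]) (by linarith) (by
          rw [div_le_iff₀ hlmin] at hN ⊢
          push_cast at hN
          linarith)
      refine ⟨D', h1, (Finset.subset_insert _ _).trans h2, ?_, fun j hj hj' => ?_⟩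
      · rw [Finset.card_insert_of_notMem hc.2] at h3
        push_cast at h3
        linarith
      · by_cases hjc : j = c
        · subst hjc
          exact ⟨by linarith, hc.1.trans hte⟩
        · have := h4 j hj (by simp [hjc, hj'])
          exact ⟨by linarith, this.2⟩
    · have hstep := step_corrupted (alg := alg) (lmin := lmin) (lmax := lmax) (E := E) hp
        (e := e) ⟨⟨he, hlt⟩, fun x hx => hE x hx.1 hx.2⟩ (not_le.1 hle)
      exact ⟨D, h.step_eq hstep, subset_rfl, by linarith, fun j hj hj' => absurd hj hj'⟩

/-- The packets that an algorithm has delivered form an offline schedule. -/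
theorem exists_isOfflineSchedule (hlmin : 0 < lmin) (hl : lmin ≤ lmax) (hE : FiniteBelow E)
    (n : ℕ) :
    ∃ S, IsOfflineSchedule lmin lmax A E (alg.state lmin lmax A E n).1 S ∧
      S.image Prod.fst = (alg.state lmin lmax A E n).2 := by
  induction n with
  | zero => exact ⟨∅, by constructor <;> simp, rfl⟩
  | succ n ih =>
    obtain ⟨S, hS, himg⟩ := ih
    have hlt := lt_step (alg := alg) (A := A) hlmin hl hE (alg.state lmin lmax A E n)
    rw [state]
    generalize alg.state lmin lmax A E n = x at *
    obtain ⟨t, D⟩ := x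
    simp only at hS himg
    rcases step_cases (alg := alg) (lmin := lmin) (lmax := lmax) (A := A) hE t D with
      ⟨hn, m, hm, h⟩ | ⟨hn, e, he, _, h⟩ | ⟨hn, hle, h⟩ <;> rw [h] at hlt ⊢
    · exact ⟨S, hS.mono hlt.le, himg⟩
    · exact ⟨S, hS.mono hlt.le, himg⟩
    · have hc := alg.choose_mem A E t D hn
      refine ⟨insert (alg.choose A E t D, t) S,
        hS.insert_transmission le_rfl hc.1 le_rfl hlt.le ?_ ?_, by simp [himg]⟩
      · rintro e he ⟨h1, h2⟩
        exact absurd (hle e he h1) (not_le.2 h2)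
      · intro x hx hxc
        refine hc.2 ?_
        rw [← hxc, ← himg]
        exact Finset.mem_image_of_mem _ hx

theorem delivered_le_optDelivered (hlmin : 0 < lmin) (hl : lmin ≤ lmax) (hE : FiniteBelow E)
    (t : ℝ) : alg.delivered lmin lmax A E t ≤ optDelivered lmin lmax A E t := by
  refine iSup₂_le fun n hn => ?_
  obtain ⟨S, hS, himg⟩ := exists_isOfflineSchedule (alg := alg) (A := A) hlmin hl hE n
  rw [← himg, Finset.sum_image]
  · exact (hS.mono hn).le_optDelivered
  · intro x hx y hy hxy
    by_contra hne
    exact hS.once x hx y hy hne hxy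

end OnlineAlgorithm

/-- This trivial bound is what is used on the exceptional events of small probability. -/
theorem throughputAt_le_one (alg : OnlineAlgorithm) {lmin lmax : ℝ} (hlmin : 0 < lmin)
    (hl : lmin ≤ lmax) (A : ArrivalPattern) {E : Set ℝ} (hE : FiniteBelow E) (t : ℝ) :
    throughputAt alg lmin lmax A E t ≤ 1 := by
  unfold throughputAt
  split_ifs
  · exact le_rfl
  · exact ENNReal.div_le_of_le_mul
      (by simpa using OnlineAlgorithm.delivered_le_optDelivered hlmin hl hE t)

/-! ### Counting arrivals of each length. -/

namespace ArrivalPattern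

/-- The number of short (`b = true`) or long (`b = false`) packets that have arrived by time `t`. -/
noncomputable def arrivals (A : ArrivalPattern) (b : Bool) (t : ℝ) : ℕ :=
  {n | A.time n ≤ t ∧ A.isShort n = b}.ncard

theorem finite_arrivals (A : ArrivalPattern) (b : Bool) (t : ℝ) :
    {n | A.time n ≤ t ∧ A.isShort n = b}.Finite :=
  (A.finite_time_le t).subset fun _ h => h.1

theorem arrivals_mono (A : ArrivalPattern) (b : Bool) : Monotone (A.arrivals b) :=
  fun _ _ h => Set.ncard_le_ncard (fun _ hn => ⟨hn.1.trans h, hn.2⟩) (A.finite_arrivals b _)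

theorem exists_of_arrivals_pos {A : ArrivalPattern} {b : Bool} {t : ℝ} (h : 0 < A.arrivals b t) :
    ∃ i, A.time i ≤ t ∧ A.isShort i = b :=
  (Set.ncard_pos (A.finite_arrivals b t)).1 h

theorem AgreeUpTo.arrivals_eq {A A' : ArrivalPattern} {t : ℝ} (h : A.AgreeUpTo A' t) (b : Bool) :
    A.arrivals b t = A'.arrivals b t := by
  unfold arrivals
  congr 1
  ext n
  simp only [Set.mem_ofPred_eq, ← h.time_le_iff n]
  exact and_congr_right fun hn => by rw [(h n (.inl hn)).2]

theorem Recurrent.exists_lt_arrivals {A : ArrivalPattern} (h : A.Recurrent) (b : Bool) (M : ℕ) :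
    ∃ t, M < A.arrivals b t := by
  obtain ⟨s, hs, hcard⟩ := (h b).exists_subset_card_eq (M + 1)
  obtain ⟨t, ht⟩ := (s.finite_toSet.image A.time).bddAbove
  refine ⟨t, ?_⟩
  have := Set.ncard_le_ncard (s := (s : Set ℕ)) (t := {n | A.time n ≤ t ∧ A.isShort n = b})
    (fun n hn => ⟨ht ⟨n, hn, rfl⟩, hs hn⟩) (A.finite_arrivals b t)
  rw [Set.ncard_coe_finset, hcard] at this
  exact this

end ArrivalPattern

/-! ### Construction and causality of the adversary. -/

/-- The windows that are picked by the seed `v`: one for every `k`. -/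
def WindowActive (v : ℝ) (n : ℕ) : Prop := ∃ k : ℕ, n = k * k + ⌊k * v⌋₊

/-- The time `t` lies in the first part of an active window. -/
def InWindow (v t : ℝ) : Prop :=
  ∃ n : ℕ, WindowActive v n ∧ (n.factorial : ℝ) ≤ t ∧ t < n * n.factorial

/-- The state of the adversary at an error event: the errors so far, the current time, the numbers
of short and long packets delivered by its own schedule, and whether it still plays in the current
window. -/
structure AdversaryState where
  errs : Set ℝ
  now : ℝ
  shorts : ℕ
  longs : ℕ
  live : Prop

namespace AdversaryState

/-- The next error is raised after `gap` time units, and the schedule of the adversary uses the time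
to deliver `a` short and `b` long packets. -/
def play (s : AdversaryState) (gap : ℝ) (a b : ℕ) (live : Prop) : AdversaryState :=
  ⟨insert (s.now + gap) s.errs, s.now + gap, s.shorts + a, s.longs + b, live⟩

/-- The adversary has a packet of each length to send. -/
def Stocked (s : AdversaryState) (A : ArrivalPattern) : Prop :=
  s.shorts < A.arrivals true s.now ∧ s.longs < A.arrivals false s.now

/-- The total length delivered by the schedule of the adversary. -/
def load (s : AdversaryState) (lmin lmax : ℝ) : ℝ := lmin * s.shorts + lmax * s.longs

end AdversaryState

/-- The algorithm starts a short packet at time `t`. -/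
def OnlineAlgorithm.StartsShort (alg : OnlineAlgorithm) (lmin lmax : ℝ) (A : ArrivalPattern)
    (E : Set ℝ) (t : ℝ) : Prop :=
  ∃ D, alg.Reaches lmin lmax A E t D ∧ (A.pending t D).Nonempty ∧
    A.isShort (alg.choose A E t D) = true

theorem OnlineAlgorithm.startsShort_congr {alg : OnlineAlgorithm} {lmin lmax : ℝ}
    {A A' : ArrivalPattern} {E E' : Set ℝ} {t : ℝ} (hlmin : 0 < lmin) (hl : lmin ≤ lmax)
    (hE : FiniteBelow E) (hE' : FiniteBelow E')
    (hA : A.AgreeUpTo A' t) (hEE : E ∩ Set.Iic t = E' ∩ Set.Iic t) :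
    alg.StartsShort lmin lmax A E t ↔ alg.StartsShort lmin lmax A' E' t := by
  refine exists_congr fun D => and_congr
    ⟨.causal hlmin hl hE hA hEE, .causal hlmin hl hE' hA.symm hEE.symm⟩ ?_
  rw [hA.pending_eq]
  refine and_congr_right fun h => ?_
  rw [← hA.pending_eq] at h
  rw [← alg.choose_causal A A' E E' t D hA hEE, (hA _ (.inl (alg.choose_mem A E t D h).1)).2]

open Classical in
/-- Outside the active windows the link is jammed. In an active window the adversary sends a long
packet when the algorithm starts a short one, and a short packet otherwise, until
it runs out of packets. -/
noncomputable def adversaryNext (alg : OnlineAlgorithm) (lmin lmax v : ℝ) (A : ArrivalPattern)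
    (s : AdversaryState) : AdversaryState :=
  if InWindow v s.now then
    if s.live ∧ s.Stocked A then
      if alg.StartsShort lmin lmax A s.errs s.now then s.play lmax 0 1 True
      else s.play lmin 1 0 True
    else s.play (lmin / 2) 0 0 False
  else s.play (lmin / 2) 0 0 True

/-- The seed of the adversary: if the interarrival times have rate `lam`, it is uniform. -/
noncomputable def ArrivalPattern.seed (lam : ℝ) (A : ArrivalPattern) : ℝ :=
  Real.exp (-(lam * A.time 0))

/-- The states of the adversary at its successive errors. -/
noncomputable def adversary (alg : OnlineAlgorithm) (lmin lmax lam : ℝ) (A : ArrivalPattern) :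
    ℕ → AdversaryState
  | 0 => ⟨{A.time 0}, A.time 0, 0, 0, True⟩
  | n + 1 => adversaryNext alg lmin lmax (A.seed lam) A (adversary alg lmin lmax lam A n)

/-- The errors of the adversary. -/
def adversaryErrors (alg : OnlineAlgorithm) (lmin lmax lam : ℝ) (A : ArrivalPattern) : Set ℝ :=
  Set.range fun n => (adversary alg lmin lmax lam A n).now

section

variable {alg : OnlineAlgorithm} {lmin lmax lam : ℝ} {A A' : ArrivalPattern}

local notation "σ" => adversary alg lmin lmax lam

theorem adversaryNext_eq_play (hlmin : 0 < lmin) (hl : lmin < lmax) (v : ℝ)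
    (s : AdversaryState) : ∃ gap a b live, lmin / 2 ≤ gap ∧ gap ≤ lmax ∧
      adversaryNext alg lmin lmax v A s = s.play gap a b live := by
  unfold adversaryNext
  split_ifs
  · exact ⟨_, _, _, _, by linarith, by linarith, rfl⟩
  · exact ⟨_, _, _, _, by linarith, by linarith, rfl⟩
  · exact ⟨_, _, _, _, by linarith, by linarith, rfl⟩
  · exact ⟨_, _, _, _, by linarith, by linarith, rfl⟩

theorem adversary_now_succ (hlmin : 0 < lmin) (hl : lmin < lmax) (n : ℕ) :
    (σ A n).now + lmin / 2 ≤ (σ A (n + 1)).now ∧ (σ A (n + 1)).now ≤ (σ A n).now + lmax ∧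
      (σ A (n + 1)).errs = insert (σ A (n + 1)).now (σ A n).errs := by
  obtain ⟨gap, a, b, live, h1, h2, h⟩ := adversaryNext_eq_play (alg := alg) (A := A) hlmin hl
    (A.seed lam) (σ A n)
  rw [adversary, h]
  simp only [AdversaryState.play]
  exact ⟨by linarith, by linarith, trivial⟩

theorem strictMono_adversary_now (hlmin : 0 < lmin) (hl : lmin < lmax) :
    StrictMono fun n => (σ A n).now :=
  strictMono_nat_of_lt_succ fun n => by
    have := (adversary_now_succ (alg := alg) (lam := lam) (A := A) hlmin hl n).1
    linarith

theorem le_adversary_now (hlmin : 0 < lmin) (hl : lmin < lmax) (n : ℕ) :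
    n * (lmin / 2) ≤ (σ A n).now := by
  induction n with
  | zero => simpa [adversary] using (A.time_pos 0).le
  | succ n ih =>
    have := (adversary_now_succ (alg := alg) (lam := lam) (A := A) hlmin hl n).1
    push_cast
    linarith

theorem tendsto_adversary_now (hlmin : 0 < lmin) (hl : lmin < lmax) :
    Tendsto (fun n => (σ A n).now) atTop atTop :=
  tendsto_atTop_mono (le_adversary_now hlmin hl)
    (tendsto_natCast_atTop_atTop.atTop_mul_const (half_pos hlmin))

theorem adversary_errs (hlmin : 0 < lmin) (hl : lmin < lmax) (n : ℕ) :
    (σ A n).errs = (fun k => (σ A k).now) '' Set.Iic n := by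
  induction n with
  | zero =>
    have : Set.Iic 0 = {0} := by ext; simp
    rw [this, Set.image_singleton]
    rfl
  | succ n ih =>
    have : Set.Iic (n + 1) = insert (n + 1) (Set.Iic n) := by
      ext
      simp only [Set.mem_Iic, Set.mem_insert_iff]
      omega
    rw [(adversary_now_succ hlmin hl n).2.2, ih, this, Set.image_insert_eq]

theorem finiteBelow_adversary_errs (hlmin : 0 < lmin) (hl : lmin < lmax) (n : ℕ) :
    FiniteBelow (σ A n).errs := fun t => by
  rw [adversary_errs hlmin hl]
  exact ((Set.finite_Iic n).image _).inter_of_left _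

theorem finiteBelow_adversaryErrors (hlmin : 0 < lmin) (hl : lmin < lmax) :
    FiniteBelow (adversaryErrors alg lmin lmax lam A) := fun t => by
  obtain ⟨N, hN⟩ := ((tendsto_adversary_now (alg := alg) (lam := lam) (A := A) hlmin
    hl).eventually_gt_atTop t).exists_forall_of_atTop
  refine ((Set.finite_lt_nat N).image fun n => (σ A n).now).subset ?_
  rintro _ ⟨⟨n, rfl⟩, hn⟩
  refine ⟨n, ?_, rfl⟩
  by_contra h
  exact absurd (hN n (not_lt.1 h)) (not_lt.2 hn)

/-- This removes the circularity between errors and choices: the adversary consults the algorithm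
run against the finitely many errors so far, and by causality this agrees with the run against all
of its errors. -/
theorem adversaryErrors_inter_Iic (hlmin : 0 < lmin) (hl : lmin < lmax) (n : ℕ) :
    adversaryErrors alg lmin lmax lam A ∩ Set.Iic (σ A n).now =
      (σ A n).errs ∩ Set.Iic (σ A n).now := by
  have hmono := strictMono_adversary_now (alg := alg) (lam := lam) (A := A) hlmin hl
  rw [adversary_errs hlmin hl]
  ext x
  constructor
  · rintro ⟨⟨k, rfl⟩, hk⟩
    exact ⟨⟨k, hmono.le_iff_le.1 hk, rfl⟩, hk⟩
  · rintro ⟨⟨k, _, rfl⟩, hk⟩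
    exact ⟨⟨k, rfl⟩, hk⟩

/-- There are no errors between two successive errors. -/
theorem le_of_mem_adversaryErrors (hlmin : 0 < lmin) (hl : lmin < lmax) {n : ℕ} {x : ℝ}
    (hx : x ∈ adversaryErrors alg lmin lmax lam A) (hlt : (σ A n).now < x) :
    (σ A (n + 1)).now ≤ x := by
  have hmono := strictMono_adversary_now (alg := alg) (lam := lam) (A := A) hlmin hl
  obtain ⟨k, rfl⟩ := hx
  exact hmono.monotone (hmono.lt_iff_lt.1 hlt)

theorem adversaryNext_congr (hlmin : 0 < lmin) (hl : lmin ≤ lmax) (v : ℝ) {s : AdversaryState}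
    (hs : FiniteBelow s.errs) (hA : A.AgreeUpTo A' s.now) :
    adversaryNext alg lmin lmax v A s = adversaryNext alg lmin lmax v A' s := by
  have hst : s.Stocked A ↔ s.Stocked A' := by
    simp only [AdversaryState.Stocked, hA.arrivals_eq]
  have hss := alg.startsShort_congr hlmin hl hs hs hA rfl
  rw [adversaryNext, adversaryNext, propext hst, propext hss]

theorem adversary_causal (hlmin : 0 < lmin) (hl : lmin < lmax) {T : ℝ} (hA : A.AgreeUpTo A' T)
    (n : ℕ) (hn : (σ A n).now ≤ T) : σ A' n = σ A n := by
  have hmono := strictMono_adversary_now (alg := alg) (lam := lam) (A := A) hlmin hl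
  have h0 : A.time 0 = A'.time 0 := (hA 0 (.inl ((hmono.monotone n.zero_le).trans hn))).1
  induction n with
  | zero => simp only [adversary, h0]
  | succ n ih =>
    have hnT := (hmono.monotone n.le_succ).trans hn
    rw [adversary, adversary, ih hnT, ArrivalPattern.seed, ArrivalPattern.seed, ← h0]
    exact (adversaryNext_congr hlmin hl.le _ (finiteBelow_adversary_errs hlmin hl n)
      (hA.mono hnT)).symm

theorem adversaryErrors_causal (hlmin : 0 < lmin) (hl : lmin < lmax) {T : ℝ}
    (hA : A.AgreeUpTo A' T) :
    adversaryErrors alg lmin lmax lam A ∩ Set.Iic T =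
      adversaryErrors alg lmin lmax lam A' ∩ Set.Iic T := by
  ext x
  constructor
  · rintro ⟨⟨k, rfl⟩, hk⟩
    exact ⟨⟨k, by simp only; rw [adversary_causal hlmin hl hA k hk]⟩, hk⟩
  · rintro ⟨⟨k, rfl⟩, hk⟩
    exact ⟨⟨k, by simp only; rw [adversary_causal hlmin hl hA.symm k hk]⟩, hk⟩

/-- The possible transitions of the adversary. -/
theorem adversary_succ_cases (hlmin : 0 < lmin) (hl : lmin < lmax) (n : ℕ) :
    (¬ InWindow (A.seed lam) (σ A n).now ∧
      σ A (n + 1) = (σ A n).play (lmin / 2) 0 0 True) ∨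
    (InWindow (A.seed lam) (σ A n).now ∧ ¬ ((σ A n).live ∧ (σ A n).Stocked A) ∧
      σ A (n + 1) = (σ A n).play (lmin / 2) 0 0 False) ∨
    (InWindow (A.seed lam) (σ A n).now ∧ (σ A n).live ∧ (σ A n).Stocked A ∧
      alg.StartsShort lmin lmax A (adversaryErrors alg lmin lmax lam A) (σ A n).now ∧
      σ A (n + 1) = (σ A n).play lmax 0 1 True) ∨
    (InWindow (A.seed lam) (σ A n).now ∧ (σ A n).live ∧ (σ A n).Stocked A ∧
      ¬ alg.StartsShort lmin lmax A (adversaryErrors alg lmin lmax lam A) (σ A n).now ∧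
      σ A (n + 1) = (σ A n).play lmin 1 0 True) := by
  have hss := alg.startsShort_congr (A := A) hlmin hl.le
    (finiteBelow_adversaryErrors (alg := alg) (lam := lam) (A := A) hlmin hl)
    (finiteBelow_adversary_errs (alg := alg) (lam := lam) (A := A) hlmin hl n)
    (fun _ _ => ⟨rfl, rfl⟩)
    (adversaryErrors_inter_Iic hlmin hl n)
  rw [hss, adversary, adversaryNext]
  split_ifs with h1 h2 h3
  · exact .inr (.inr (.inl ⟨h1, h2.1, h2.2, h3, rfl⟩))
  · exact .inr (.inr (.inr ⟨h1, h2.1, h2.2, h3, rfl⟩))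
  · exact .inr (.inl ⟨h1, h2, rfl⟩)
  · exact .inl ⟨h1, rfl⟩

/-! ### The adversary's own schedule, and what the algorithm delivers against it. -/

/-- By pigeonhole some arrived packet of the wanted length is not yet scheduled; started at `t`, it
ends by `t'`, before which no further error occurs. -/
theorem IsOfflineSchedule.exists_extend {E : Set ℝ} {t t' : ℝ} {S : Finset (ℕ × ℝ)}
    (hS : IsOfflineSchedule lmin lmax A E t S) {b : Bool}
    (hb : (S.filter fun x => A.isShort x.1 = b).card < A.arrivals b t)
    (htt : t ≤ t') (hlen : t + (if b = true then lmin else lmax) ≤ t')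
    (hE : ∀ e ∈ E, t < e → t' ≤ e) :
    ∃ i, A.isShort i = b ∧ (i, t) ∉ S ∧
      IsOfflineSchedule lmin lmax A E t' (insert (i, t) S) := by
  have : (((S.filter fun x => A.isShort x.1 = b).image Prod.fst : Finset ℕ) : Set ℕ).ncard <
      {n | A.time n ≤ t ∧ A.isShort n = b}.ncard := by
    rw [Set.ncard_coe_finset]
    exact Finset.card_image_le.trans_lt hb
  obtain ⟨i, ⟨hi, hib⟩, hiS⟩ := Set.exists_mem_notMem_of_ncard_lt_ncard this
  have hiS' : ∀ x ∈ S, x.1 ≠ i := by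
    rintro x hx rfl
    refine hiS ?_
    simp only [Finset.coe_image, Finset.coe_filter, Set.mem_image]
    exact ⟨x, ⟨hx, hib⟩, rfl⟩
  have hlen' : t + A.length lmin lmax i ≤ t' := by
    rwa [ArrivalPattern.length, hib]
  refine ⟨i, hib, fun h => hiS' _ h rfl, hS.insert_transmission le_rfl hi hlen' htt ?_ hiS'⟩
  rintro e he ⟨h1, h2⟩
  exact absurd (hE e he h1) (by linarith)

/-- The schedule of the adversary. -/
theorem adversary_schedule (hlmin : 0 < lmin) (hl : lmin < lmax) (n : ℕ) :
    ∃ S, IsOfflineSchedule lmin lmax A (adversaryErrors alg lmin lmax lam A) (σ A n).now S ∧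
      (S.filter fun x => A.isShort x.1 = true).card = (σ A n).shorts ∧
      (S.filter fun x => A.isShort x.1 = false).card = (σ A n).longs := by
  induction n with
  | zero => exact ⟨∅, by constructor <;> simp, rfl, rfl⟩
  | succ n ih =>
    obtain ⟨S, hS, h1, h2⟩ := ih
    have hle := (strictMono_adversary_now (alg := alg) (lam := lam) (A := A) hlmin hl).monotone
      n.le_succ
    have herr := fun x hx => le_of_mem_adversaryErrors (alg := alg) (lam := lam) (A := A)
      (n := n) hlmin hl (x := x) hx
    rcases adversary_succ_cases (alg := alg) (lam := lam) (A := A) hlmin hl n with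
      ⟨_, h⟩ | ⟨_, _, h⟩ | ⟨_, _, hst, _, h⟩ | ⟨_, _, hst, _, h⟩
    · exact ⟨S, hS.mono hle, by rw [h1, h]; rfl, by rw [h2, h]; rfl⟩
    · exact ⟨S, hS.mono hle, by rw [h1, h]; rfl, by rw [h2, h]; rfl⟩
    · obtain ⟨i, hib, hiS, hS'⟩ := hS.exists_extend (b := false) (h2 ▸ hst.2) hle
        (by rw [h]; simp [AdversaryState.play]) herr
      refine ⟨_, hS', ?_, ?_⟩
      · rw [h, Finset.filter_insert]
        simp [hib, h1, AdversaryState.play]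
      · rw [h, Finset.filter_insert]
        simp [hib, h2, AdversaryState.play, hiS]
    · obtain ⟨i, hib, hiS, hS'⟩ := hS.exists_extend (b := true) (h1 ▸ hst.1) hle
        (by rw [h]; simp [AdversaryState.play]) herr
      refine ⟨_, hS', ?_, ?_⟩
      · rw [h, Finset.filter_insert]
        simp [hib, h1, AdversaryState.play, hiS]
      · rw [h, Finset.filter_insert]
        simp [hib, h2, AdversaryState.play]

theorem sum_length_eq (S : Finset (ℕ × ℝ)) : ∑ x ∈ S, A.length lmin lmax x.1 =
    lmin * (S.filter fun x => A.isShort x.1 = true).card +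
      lmax * (S.filter fun x => A.isShort x.1 = false).card := by
  simp only [ArrivalPattern.length, Finset.sum_ite, Finset.sum_const, nsmul_eq_mul,
    Bool.not_eq_true]
  ring

theorem load_le_optDelivered (hlmin : 0 < lmin) (hl : lmin < lmax) (n : ℕ) {t : ℝ}
    (ht : (σ A n).now ≤ t) :
    ENNReal.ofReal ((σ A n).load lmin lmax) ≤
      optDelivered lmin lmax A (adversaryErrors alg lmin lmax lam A) t := by
  obtain ⟨S, hS, h1, h2⟩ := adversary_schedule (alg := alg) (lam := lam) (A := A) hlmin hl n
  rw [AdversaryState.load, ← h1, ← h2, ← sum_length_eq]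
  exact (hS.mono ht).le_optDelivered

theorem longs_le_arrivals (hlmin : 0 < lmin) (hl : lmin < lmax) (n : ℕ) :
    (σ A n).longs ≤ A.arrivals false (σ A n).now := by
  induction n with
  | zero => exact Nat.zero_le _
  | succ n ih =>
    have hle := A.arrivals_mono false ((strictMono_adversary_now (alg := alg) (lam := lam) (A := A)
      hlmin hl).monotone n.le_succ)
    rcases adversary_succ_cases (alg := alg) (lam := lam) (A := A) hlmin hl n with
      ⟨_, h⟩ | ⟨_, _, h⟩ | ⟨_, _, hst, _, h⟩ | ⟨_, _, hst, _, h⟩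
    · refine le_trans ?_ hle
      rw [h]; exact ih
    · refine le_trans ?_ hle
      rw [h]; exact ih
    · refine le_trans ?_ hle
      rw [h]; exact hst.2
    · refine le_trans ?_ hle
      rw [h]; exact ih

/-- What the algorithm has delivered at the `n`-th error: a set of short packets, at least one and
at most `⌊lmax / lmin⌋₊` for each long packet delivered by the schedule of the adversary. -/
structure AdversaryInvariant (alg : OnlineAlgorithm) (lmin lmax lam : ℝ) (A : ArrivalPattern)
    (n : ℕ) (D : Finset ℕ) : Prop where
  reaches : alg.Reaches lmin lmax A (adversaryErrors alg lmin lmax lam A)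
    (adversary alg lmin lmax lam A n).now D
  isShort : ∀ i ∈ D, A.isShort i = true
  time_le : ∀ i ∈ D, A.time i ≤ (adversary alg lmin lmax lam A n).now
  longs_le : (adversary alg lmin lmax lam A n).longs ≤ D.card
  card_le : D.card ≤ ⌊lmax / lmin⌋₊ * (adversary alg lmin lmax lam A n).longs

theorem AdversaryInvariant.exists_long {n : ℕ} {D : Finset ℕ}
    (hD : AdversaryInvariant alg lmin lmax lam A n D) (h : 0 < A.arrivals false (σ A n).now) :
    ∃ i, A.time i ≤ (σ A n).now ∧ i ∉ D ∧ A.length lmin lmax i = lmax := by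
  obtain ⟨i, hi, hi'⟩ := ArrivalPattern.exists_of_arrivals_pos h
  refine ⟨i, hi, fun hiD => ?_, ArrivalPattern.length_of_not_isShort hi'⟩
  simp [hD.isShort i hiD] at hi'

/-- The algorithm delivers nothing while the link is jammed. -/
theorem AdversaryInvariant.jam (hlmin : 0 < lmin) (hl : lmin < lmax) {n : ℕ} {D : Finset ℕ}
    (hD : AdversaryInvariant alg lmin lmax lam A n D) {live : Prop}
    (h : σ A (n + 1) = (σ A n).play (lmin / 2) 0 0 live) :
    AdversaryInvariant alg lmin lmax lam A (n + 1) D := by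
  have hmono := strictMono_adversary_now (alg := alg) (lam := lam) (A := A) hlmin hl
  have hlt : (σ A n).now < (σ A (n + 1)).now := hmono n.lt_succ_self
  have hnow : (σ A (n + 1)).now = (σ A n).now + lmin / 2 := by rw [h]; rfl
  have hlongs : (σ A (n + 1)).longs = (σ A n).longs := by rw [h]; rfl
  -- Something is always pending: packet `0` if nothing is delivered; otherwise the adversary has
  -- sent a long packet, so one has arrived, and the algorithm has delivered none.
  obtain ⟨i, hi, hiD⟩ : ∃ i, A.time i ≤ (σ A n).now ∧ i ∉ D := by
    rcases D.eq_empty_or_nonempty with rfl | hne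
    · exact ⟨0, hmono.monotone n.zero_le, by simp⟩
    · have : 0 < (σ A n).longs := by
        by_contra h0
        have h1 := hne.card_pos
        have h2 := hD.card_le
        simp only [Nat.le_zero.1 (not_lt.1 h0), mul_zero] at h2
        omega
      obtain ⟨i, hi, hiD, _⟩ := hD.exists_long (this.trans_le (longs_le_arrivals hlmin hl n))
      exact ⟨i, hi, hiD⟩
  have hil := A.le_length (lmin := lmin) (lmax := lmax) hl.le i
  obtain ⟨D', h1, h2, h3, h4⟩ := hD.reaches.next_error hlmin hl.le ⟨n + 1, rfl⟩ hlt.le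
    -- The gap `lmin / 2` is too short for any packet.
    (fun x hx => le_of_mem_adversaryErrors hlmin hl hx) hi hiD (by dsimp only; linarith)
  have hDD : D' = D := by
    refine subset_antisymm (fun j hj => ?_) h2
    by_contra hjD
    have := (h4 j hj hjD).1
    have := A.le_length (lmin := lmin) (lmax := lmax) hl.le j
    dsimp only at *
    linarith
  subst hDD
  exact ⟨h1, hD.isShort, fun i hi => (hD.time_le i hi).trans hlt.le, hlongs ▸ hD.longs_le,
    hlongs ▸ hD.card_le⟩

theorem exists_adversaryInvariant (hlmin : 0 < lmin) (hl : lmin < lmax) (n : ℕ) :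
    ∃ D, AdversaryInvariant alg lmin lmax lam A n D := by
  induction n with
  | zero => exact ⟨∅, OnlineAlgorithm.reaches_first_arrival, by simp, by simp, le_rfl,
      Nat.zero_le _⟩
  | succ n ih =>
    obtain ⟨D, hD⟩ := ih
    have hlt : (σ A n).now < (σ A (n + 1)).now :=
      strictMono_adversary_now (alg := alg) (lam := lam) (A := A) hlmin hl n.lt_succ_self
    have herr := fun x hx => le_of_mem_adversaryErrors (alg := alg) (lam := lam) (A := A)
      (n := n) hlmin hl (x := x) hx
    have hmem : (σ A (n + 1)).now ∈ adversaryErrors alg lmin lmax lam A := ⟨n + 1, rfl⟩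
    rcases adversary_succ_cases (alg := alg) (lam := lam) (A := A) hlmin hl n with
      ⟨_, h⟩ | ⟨_, _, h⟩ | ⟨_, _, hst, ⟨D₀, hD₀, hp, hc⟩, h⟩ | ⟨_, _, hst, hns, h⟩
    · exact ⟨D, hD.jam hlmin hl h⟩
    · exact ⟨D, hD.jam hlmin hl h⟩
    · obtain rfl := hD.reaches.unique hlmin hl.le (finiteBelow_adversaryErrors hlmin hl) hD₀
      have hnow : (σ A (n + 1)).now = (σ A n).now + lmax := by rw [h]; rfl
      have hlongs : (σ A (n + 1)).longs = (σ A n).longs + 1 := by rw [h]; rfl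
      have hcm := alg.choose_mem A (adversaryErrors alg lmin lmax lam A) _ _ hp
      have hlen := ArrivalPattern.length_of_isShort (lmin := lmin) (lmax := lmax) hc
      have hstep := OnlineAlgorithm.step_delivered (alg := alg) (lmin := lmin) (lmax := lmax) hp
        (E := adversaryErrors alg lmin lmax lam A) fun x hx htx => by
          have := herr x hx htx
          rw [hlen]
          linarith
      rw [hlen] at hstep
      set c := alg.choose A (adversaryErrors alg lmin lmax lam A) (σ A n).now D with hcdef
      -- The first short packet `c` is delivered after `lmin`. An undelivered long packet then keeps
      -- the link busy for the remaining `lmax - lmin`, in which only packets shorter than `lmax`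
      -- fit.
      obtain ⟨i, hi, hiD, hil⟩ := hD.exists_long ((Nat.zero_le _).trans_lt hst.2)
      have hic : i ≠ c := by
        rintro rfl
        linarith
      obtain ⟨D', h1, h2, h3, h4⟩ := (hD.reaches.step_eq hstep).next_error hlmin hl.le hmem
        (by linarith) (fun x hx htx => herr x hx (by linarith)) (by linarith)
        (by simp [hic, hiD]) (by linarith)
      have hcard : (insert c D).card = D.card + 1 := Finset.card_insert_of_notMem hcm.2
      have hD' : ∀ j ∈ D', A.isShort j = true ∧ A.time j ≤ (σ A (n + 1)).now := fun j hj => by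
        by_cases hjD : j ∈ insert c D
        · rcases Finset.mem_insert.1 hjD with rfl | hjD
          · exact ⟨hc, hcm.1.trans hlt.le⟩
          · exact ⟨hD.isShort j hjD, (hD.time_le j hjD).trans hlt.le⟩
        · have := h4 j hj hjD
          exact ⟨ArrivalPattern.isShort_of_length_lt (lmin := lmin) (lmax := lmax)
            (by linarith), this.2⟩
      have hge := hD.longs_le
      have hle := hD.card_le
      refine ⟨D', h1, fun j hj => (hD' j hj).1, fun j hj => (hD' j hj).2, ?_, ?_⟩
      · have := Finset.card_le_card h2
        omega
      · rw [hcard] at h3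
        have hsub : D.card ≤ D'.card :=
          Finset.card_le_card ((Finset.subset_insert _ _).trans h2)
        -- The packet `c` uses `lmin` and the others share `lmax - lmin`, so all the new packets
        -- together fit into `lmax`.
        have : D'.card - D.card ≤ ⌊lmax / lmin⌋₊ := by
          rw [Nat.le_floor_iff (by have := hlmin.trans hl; positivity), le_div_iff₀ hlmin,
            Nat.cast_sub hsub]
          push_cast at h3
          linarith
        rw [hlongs, mul_add, mul_one]
        omega
    · have hnow : (σ A (n + 1)).now = (σ A n).now + lmin := by rw [h]; rfl
      have hlongs : (σ A (n + 1)).longs = (σ A n).longs := by rw [h]; rfl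
      obtain ⟨i, hi, hiD, _⟩ := hD.exists_long ((Nat.zero_le _).trans_lt hst.2)
      have hp : (A.pending (σ A n).now D).Nonempty := ⟨i, hi, hiD⟩
      -- The link is free and a packet is pending, so not starting a short packet means starting a
      -- long one, which the error after `lmin < lmax` corrupts.
      have hc : A.isShort (alg.choose A (adversaryErrors alg lmin lmax lam A) (σ A n).now D) =
          false := by
        by_contra hc
        exact hns ⟨D, hD.reaches, hp, by simpa using hc⟩
      have hstep := OnlineAlgorithm.step_corrupted (alg := alg) (lmin := lmin) (lmax := lmax) hp
        (E := adversaryErrors alg lmin lmax lam A) ⟨⟨hmem, hlt⟩, fun x hx => herr x hx.1 hx.2⟩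
        (by rw [ArrivalPattern.length_of_not_isShort hc]; linarith)
      exact ⟨D, hD.reaches.step_eq hstep, hD.isShort,
        fun i hi => (hD.time_le i hi).trans hlt.le, hlongs ▸ hD.longs_le, hlongs ▸ hD.card_le⟩

end

/-! ### Active windows, nontrivial communication, and the delivered ratio. -/

section

variable {alg : OnlineAlgorithm} {lmin lmax lam : ℝ} {A : ArrivalPattern}

local notation "σ" => adversary alg lmin lmax lam

theorem ArrivalPattern.seed_pos (lam : ℝ) (A : ArrivalPattern) : 0 < A.seed lam := Real.exp_pos _

theorem ArrivalPattern.seed_lt_one (hlam : 0 < lam) (A : ArrivalPattern) : A.seed lam < 1 :=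
  Real.exp_lt_one_iff.2 (neg_lt_zero.2 (mul_pos hlam (A.time_pos 0)))

theorem exists_windowActive {v : ℝ} (h1 : v ≤ 1) (M : ℕ) :
    ∃ n, M ≤ n ∧ n ≤ M * M + M ∧ WindowActive v n := by
  refine ⟨M * M + ⌊M * v⌋₊, (Nat.le_mul_self M).trans (Nat.le_add_right _ _), ?_, M, rfl⟩
  have : ⌊M * v⌋₊ ≤ M := by
    refine Nat.floor_le_of_le ?_
    exact mul_le_of_le_one_right M.cast_nonneg h1
  omega

theorem mul_factorial_mono {m n : ℕ} (h : m ≤ n) :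
    (m * m.factorial : ℝ) ≤ n * n.factorial := by
  exact_mod_cast Nat.mul_le_mul h (Nat.factorial_le h)

/-- Window `n + 1` ends a time `(n + 1)!` before window `n + 2` could begin, which leaves room for
the last transmission to overrun by up to `lmax`. -/
theorem succ_mul_factorial_add (n : ℕ) :
    ((n + 1 : ℕ) : ℝ) * (n + 1).factorial + (n + 1).factorial = (n + 2).factorial := by
  rw [Nat.factorial_succ (n + 1)]
  push_cast
  ring

theorem exists_adversary_crossing (hlmin : 0 < lmin) (hl : lmin < lmax) {x : ℝ}
    (hx : A.time 0 < x) : ∃ j, (σ A j).now < x ∧ x ≤ (σ A (j + 1)).now := by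
  classical
  have hex : ∃ k, x ≤ (σ A k).now :=
    ((tendsto_adversary_now (alg := alg) (lam := lam) (A := A) hlmin hl).eventually_ge_atTop
      x).exists
  have h0 : Nat.find hex ≠ 0 := fun h => by
    have := Nat.find_spec hex
    rw [h] at this
    exact absurd this (not_le.2 hx)
  obtain ⟨j, hj⟩ := Nat.exists_eq_succ_of_ne_zero h0
  refine ⟨j, not_le.1 (Nat.find_min hex (hj ▸ j.lt_succ_self)), ?_⟩
  have := Nat.find_spec hex
  rwa [hj] at this

/-- The adversary plays at the beginning of every active window. -/
theorem exists_live (hlmin : 0 < lmin) (hl : lmin < lmax) {n : ℕ}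
    (hn : lmax ≤ n.factorial) (h0 : A.time 0 < (n + 1).factorial) :
    ∃ j, ((n + 1).factorial : ℝ) ≤ (σ A j).now ∧ (σ A j).now < (n + 1).factorial + lmax ∧
      (σ A j).live := by
  obtain ⟨j, hj1, hj2⟩ := exists_adversary_crossing (alg := alg) (lam := lam) hlmin hl h0
  have hj3 := (adversary_now_succ (alg := alg) (lam := lam) (A := A) hlmin hl j).2.1
  refine ⟨j + 1, hj2, by linarith, ?_⟩
  -- The last error before `(n + 1)!` is at least `(n + 1)! - lmax ≥ n * n!`, past all earlier
  -- windows; jamming there makes the adversary live again.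
  have hnot : ¬ InWindow (A.seed lam) (σ A j).now := by
    rintro ⟨m, _, hm1, hm2⟩
    have hmn : m < n + 1 := by
      by_contra h
      have : ((n + 1).factorial : ℝ) ≤ m.factorial := by
        exact_mod_cast Nat.factorial_le (not_lt.1 h)
      linarith
    have h1 := mul_factorial_mono (Nat.lt_succ_iff.1 hmn)
    have h2 : ((n + 1).factorial : ℝ) = n * n.factorial + n.factorial := by
      rw [Nat.factorial_succ]; push_cast; ring
    linarith
  rcases adversary_succ_cases (alg := alg) (lam := lam) (A := A) hlmin hl j with
    ⟨_, h⟩ | ⟨hw, _⟩ | ⟨hw, _⟩ | ⟨hw, _⟩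
  · rw [h]; trivial
  · exact absurd hw hnot
  · exact absurd hw hnot
  · exact absurd hw hnot

theorem shorts_add_longs_mono (hlmin : 0 < lmin) (hl : lmin < lmax) :
    Monotone fun n => (σ A n).shorts + (σ A n).longs := by
  refine monotone_nat_of_le_succ fun n => ?_
  rcases adversary_succ_cases (alg := alg) (lam := lam) (A := A) hlmin hl n with
    ⟨_, h⟩ | ⟨_, _, h⟩ | ⟨_, _, _, _, h⟩ | ⟨_, _, _, _, h⟩ <;> rw [h] <;>
    simp only [AdversaryState.play] <;> omega

theorem eventually_factorial_ge (x : ℝ) : ∀ᶠ n : ℕ in atTop, x ≤ n.factorial := by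
  filter_upwards [tendsto_natCast_atTop_atTop.eventually_ge_atTop x] with n hn
  exact hn.trans (by exact_mod_cast n.self_le_factorial)

/-- If the count were stuck at `B`, then at the beginning of a late active window more than `B`
packets of each length would have arrived, so the adversary would be live and stocked and would send
another one. -/
theorem exists_le_shorts_add_longs (hlmin : 0 < lmin) (hl : lmin < lmax) (hlam : 0 < lam)
    (hA : A.Recurrent) (B : ℕ) : ∃ n, B ≤ (σ A n).shorts + (σ A n).longs := by
  induction B with
  | zero => exact ⟨0, Nat.zero_le _⟩
  | succ B ih =>
    by_contra! hcon
    obtain ⟨k, hk⟩ := ih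
    have hmono := shorts_add_longs_mono (alg := alg) (lam := lam) (A := A) hlmin hl
    obtain ⟨t₁, ht₁⟩ := hA.exists_lt_arrivals true (B + 1)
    obtain ⟨t₂, ht₂⟩ := hA.exists_lt_arrivals false (B + 1)
    obtain ⟨M, hM⟩ := ((eventually_factorial_ge t₁).and ((eventually_factorial_ge t₂).and
      ((eventually_factorial_ge lmax).and ((eventually_factorial_ge (A.time 0 + 1)).and
        (eventually_factorial_ge (σ A k).now))))).exists_forall_of_atTop
    obtain ⟨n, hMn, _, hact⟩ := exists_windowActive (A.seed_lt_one hlam).le (M + 2)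
    obtain ⟨n, rfl⟩ : ∃ n', n = n' + 1 := ⟨n - 1, by omega⟩
    have hMn' := hM (n + 1) (by omega)
    obtain ⟨j, hj1, hj2, hlive⟩ := exists_live (alg := alg) (lam := lam) (A := A) hlmin hl
      (hM n (by omega)).2.2.1 (by linarith [hMn'.2.2.2.1])
    have hn2 : (2 : ℝ) * (n + 1).factorial ≤ (n + 1 : ℕ) * (n + 1).factorial := by
      have : 2 ≤ n + 1 := by omega
      gcongr
      exact_mod_cast this
    have hwin : InWindow (A.seed lam) (σ A j).now :=
      ⟨n + 1, hact, hj1, by linarith [hMn'.2.2.1]⟩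
    have hcj := hcon j
    have hcj' := hcon (j + 1)
    have hkj : B ≤ (σ A j).shorts + (σ A j).longs := hk.trans (hmono
      ((strictMono_adversary_now (alg := alg) (lam := lam) (A := A) hlmin hl).le_iff_le.1
        (hMn'.2.2.2.2.trans hj1)))
    have hst : (σ A j).Stocked A := by
      have h1 := A.arrivals_mono true (hMn'.1.trans hj1)
      have h2 := A.arrivals_mono false (hMn'.2.1.trans hj1)
      constructor <;> omega
    rcases adversary_succ_cases (alg := alg) (lam := lam) (A := A) hlmin hl j with
      ⟨hw, _⟩ | ⟨_, hw, _⟩ | ⟨_, _, _, _, h⟩ | ⟨_, _, _, _, h⟩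
    · exact hw hwin
    · exact hw ⟨hlive, hst⟩
    · rw [h] at hcj'
      simp only [AdversaryState.play] at hcj'
      omega
    · rw [h] at hcj'
      simp only [AdversaryState.play] at hcj'
      omega

/-- The adversary as an error function. -/
def adversaryErrorFunction (alg : OnlineAlgorithm) (lmin lmax lam : ℝ) (hlmin : 0 < lmin)
    (hl : lmin < lmax) (hlam : 0 < lam) : ErrorFunction lmin lmax where
  errors := adversaryErrors alg lmin lmax lam
  nonneg := by
    rintro A _ ⟨n, rfl⟩
    exact (by positivity : (0 : ℝ) ≤ n * (lmin / 2)).trans (le_adversary_now hlmin hl n)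
  locallyFinite A t := finiteBelow_adversaryErrors hlmin hl t
  causal A A' t h := adversaryErrors_causal hlmin hl h
  nontrivial A hA M := by
    obtain ⟨B, hB⟩ := exists_nat_ge (M / lmin)
    obtain ⟨n, hn⟩ := exists_le_shorts_add_longs (alg := alg) hlmin hl hlam hA B
    refine ⟨_, (ENNReal.ofReal_le_ofReal ?_).trans
      (load_le_optDelivered (alg := alg) (lam := lam) hlmin hl n le_rfl)⟩
    rw [div_le_iff₀ hlmin] at hB
    have h1 : (B : ℝ) ≤ (adversary alg lmin lmax lam A n).shorts +
      (adversary alg lmin lmax lam A n).longs := by exact_mod_cast hn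
    have h2 : lmin * ((adversary alg lmin lmax lam A n).longs : ℝ) ≤
      lmax * (adversary alg lmin lmax lam A n).longs := by gcongr
    have h3 := mul_le_mul_of_nonneg_left h1 hlmin.le
    unfold AdversaryState.load
    linarith

/-- At the `n`-th error the algorithm has delivered at most `c` times as much as the
adversary. -/
def RatioLE (alg : OnlineAlgorithm) (lmin lmax lam : ℝ) (A : ArrivalPattern) (c : ℝ) (n : ℕ) :
    Prop :=
  ∃ D, AdversaryInvariant alg lmin lmax lam A n D ∧
    lmin * D.card ≤ c * (adversary alg lmin lmax lam A n).load lmin lmax ∧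
    0 < (adversary alg lmin lmax lam A n).load lmin lmax

theorem RatioLE.jam (hlmin : 0 < lmin) (hl : lmin < lmax) {c : ℝ} {n : ℕ} {live : Prop}
    (h : RatioLE alg lmin lmax lam A c n)
    (hn : σ A (n + 1) = (σ A n).play (lmin / 2) 0 0 live) :
    RatioLE alg lmin lmax lam A c (n + 1) := by
  obtain ⟨D, hD, h1, h2⟩ := h
  have : (σ A (n + 1)).load lmin lmax = (σ A n).load lmin lmax := by rw [hn]; rfl
  exact ⟨D, hD.jam hlmin hl hn, this ▸ h1, this ▸ h2⟩

theorem AdversaryInvariant.card_le_arrivals {n : ℕ} {D : Finset ℕ}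
    (hD : AdversaryInvariant alg lmin lmax lam A n D) :
    D.card ≤ A.arrivals true (σ A n).now := by
  rw [← Set.ncard_coe_finset]
  exact Set.ncard_le_ncard (fun i hi => ⟨hD.time_le i hi, hD.isShort i hi⟩)
    (A.finite_arrivals _ _)

/-- This is the `γ / ρ` bound; it holds at every error, inside windows as well as outside. -/
theorem AdversaryInvariant.mul_card_le (hlmin : 0 < lmin) (hl : lmin < lmax) {n : ℕ}
    {D : Finset ℕ} (hD : AdversaryInvariant alg lmin lmax lam A n D) :
    lmin * D.card ≤ ⌊lmax / lmin⌋₊ / (lmax / lmin) * (lmax * (σ A n).longs) := by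
  have hlmax := hlmin.trans hl
  have : (D.card : ℝ) ≤ ⌊lmax / lmin⌋₊ * (σ A n).longs := by exact_mod_cast hD.card_le
  calc lmin * D.card ≤ lmin * (⌊lmax / lmin⌋₊ * (σ A n).longs) := by gcongr
    _ = _ := by field_simp

/-- If the adversary has delivered all short packets, the ratio is small. -/
theorem AdversaryInvariant.ratio_of_all_shorts (hlmin : 0 < lmin) (hl : lmin < lmax) {n : ℕ}
    {D : Finset ℕ} (hD : AdversaryInvariant alg lmin lmax lam A n D)
    (h : D.card ≤ (σ A n).shorts) :
    lmin * D.card ≤ ⌊lmax / lmin⌋₊ / (lmax / lmin + ⌊lmax / lmin⌋₊) *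
      (σ A n).load lmin lmax := by
  have hlmax := hlmin.trans hl
  have h1 := hD.mul_card_le hlmin hl
  have hS : lmin * (D.card : ℝ) ≤ lmin * (σ A n).shorts := by
    have : (D.card : ℝ) ≤ (σ A n).shorts := by exact_mod_cast h
    gcongr
  set G : ℝ := (⌊lmax / lmin⌋₊ : ℝ)
  have hG : 0 ≤ G := Nat.cast_nonneg _
  have hρ : 0 < lmax / lmin := by positivity
  rw [div_mul_eq_mul_div, le_div_iff₀ hρ] at h1
  rw [div_mul_eq_mul_div, le_div_iff₀ (by positivity), AdversaryState.load]
  -- With `x` the delivered length, and `L`, `S` the long and short loads of the adversary, `ρ x ≤ G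
  -- L` and `x ≤ S` add up to `(ρ + G) x ≤ G (L + S)`.
  nlinarith [mul_le_mul_of_nonneg_left hS hG]

/-- The ratio is small at the end of every active window, if few short packets arrive, and more
long ones. -/
theorem exists_ratioLE (hlmin : 0 < lmin) (hl : lmin < lmax) {c₁ c₂ : ℝ} {n : ℕ}
    (hn : lmax ≤ n.factorial) (h0 : A.time 0 < (n + 1).factorial)
    (hact : WindowActive (A.seed lam) (n + 1))
    (hfew : ∀ t, ((n + 1).factorial : ℝ) ≤ t → lmin * A.arrivals true t ≤ c₁ * t)
    (hmore : ∀ t, ((n + 1).factorial : ℝ) ≤ t → A.arrivals true t < A.arrivals false t)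
    (hpos : ∀ t, ((n + 1).factorial : ℝ) ≤ t → 0 < A.arrivals true t)
    (hc₂ : 0 ≤ c₂)
    (hc : ∀ t, ((n + 1 : ℕ) * (n + 1).factorial : ℝ) ≤ t →
      (n + 1).factorial + lmax < t ∧ c₁ * t ≤ c₂ * (t - (n + 1).factorial - lmax)) :
    ∃ j, ((n + 1 : ℕ) * (n + 1).factorial : ℝ) ≤ (σ A j).now ∧
      (σ A j).now < (n + 1 : ℕ) * (n + 1).factorial + lmax ∧
      RatioLE alg lmin lmax lam A
        (max c₂ (⌊lmax / lmin⌋₊ / (lmax / lmin + ⌊lmax / lmin⌋₊))) j := by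
  have hmono := strictMono_adversary_now (alg := alg) (lam := lam) (A := A) hlmin hl
  obtain ⟨j₀, hj1, hj2, hlive⟩ := exists_live (alg := alg) (lam := lam) (A := A) hlmin hl hn h0
  set F : ℝ := ((n + 1).factorial : ℝ) with hF
  set W : ℝ := (n + 1 : ℕ) * F with hW
  set g : ℝ := ⌊lmax / lmin⌋₊ / (lmax / lmin + ⌊lmax / lmin⌋₊) with hg
  have hFW : F ≤ W := by
    have : (1 : ℝ) ≤ (n + 1 : ℕ) := by exact_mod_cast Nat.le_add_left 1 n
    exact le_mul_of_one_le_left (Nat.cast_nonneg _) this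
  -- Within the window the adversary either is live and has been sending without a break since `j₀`,
  -- or has stopped with the ratio frozen below `g`.
  have hplay : ∀ i, (∀ i' < i, (σ A (j₀ + i')).now < W) →
      ((σ A (j₀ + i)).live ∧
        (σ A (j₀ + i)).now - (σ A j₀).now ≤ (σ A (j₀ + i)).load lmin lmax) ∨
      (¬ (σ A (j₀ + i)).live ∧ RatioLE alg lmin lmax lam A g (j₀ + i)) := by
    intro i
    induction i with
    | zero =>
      intro _
      have := hlmin.trans hl
      refine .inl ⟨hlive, ?_⟩
      rw [add_zero, sub_self, AdversaryState.load]
      positivity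
    | succ i ih =>
      intro hi
      have hlow : F ≤ (σ A (j₀ + i)).now := hj1.trans (hmono.monotone (Nat.le_add_right _ _))
      have hwin : InWindow (A.seed lam) (σ A (j₀ + i)).now :=
        ⟨n + 1, hact, hlow, hi i i.lt_succ_self⟩
      have hih := ih fun i' hi' => hi i' (hi'.trans i.lt_succ_self)
      rw [← add_assoc]
      rcases adversary_succ_cases (alg := alg) (lam := lam) (A := A) hlmin hl (j₀ + i) with
        ⟨hw, _⟩ | ⟨_, hw, h⟩ | ⟨_, hlv, _, _, h⟩ | ⟨_, hlv, _, _, h⟩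
      · exact absurd hwin hw
      · refine .inr ⟨by rw [h]; exact id, RatioLE.jam hlmin hl ?_ h⟩
        rcases hih with ⟨hlv, _⟩ | ⟨_, hr⟩
        · obtain ⟨D, hD⟩ := exists_adversaryInvariant (alg := alg) (lam := lam) (A := A) hlmin hl
            (j₀ + i)
          have hcard := hD.card_le_arrivals
          have hlong := hD.longs_le
          have hm := hmore _ hlow
          have hp := hpos _ hlow
          -- Long packets cannot be what is missing: those sent number at most `D.card`, hence at
          -- most the short arrivals, which are fewer than the long ones.
          have hsh : A.arrivals true (σ A (j₀ + i)).now ≤ (σ A (j₀ + i)).shorts := by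
            by_contra hcon
            exact hw ⟨hlv, not_le.1 hcon, by omega⟩
          refine ⟨D, hD, hD.ratio_of_all_shorts hlmin hl (hcard.trans hsh), ?_⟩
          have h1 : (0 : ℝ) < (σ A (j₀ + i)).shorts := by exact_mod_cast hp.trans_le hsh
          have := hlmin.trans hl
          unfold AdversaryState.load
          positivity
        · exact hr
      · rcases hih with ⟨_, hload⟩ | ⟨hnl, _⟩
        · refine .inl ⟨by rw [h]; trivial, ?_⟩
          rw [h]
          simp only [AdversaryState.load, AdversaryState.play] at hload ⊢
          push_cast
          linarith
        · exact absurd hlv hnl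
      · rcases hih with ⟨_, hload⟩ | ⟨hnl, _⟩
        · refine .inl ⟨by rw [h]; trivial, ?_⟩
          rw [h]
          simp only [AdversaryState.load, AdversaryState.play] at hload ⊢
          push_cast
          linarith
        · exact absurd hlv hnl
  obtain ⟨J, hJ1, hJ2⟩ := exists_adversary_crossing (alg := alg) (lam := lam) (A := A) hlmin hl
    (h0.trans_le hFW)
  have hjJ : j₀ ≤ J := by
    have : (σ A j₀).now < (σ A (J + 1)).now :=
      (hj2.trans_le (hc W le_rfl).1.le).trans_le hJ2
    exact Nat.lt_succ_iff.1 (hmono.lt_iff_lt.1 this)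
  obtain ⟨i, rfl⟩ := Nat.exists_eq_add_of_le hjJ
  have hJ3 := (adversary_now_succ (alg := alg) (lam := lam) (A := A) hlmin hl (j₀ + i)).2.1
  refine ⟨j₀ + i + 1, hJ2, by linarith, ?_⟩
  rcases hplay (i + 1) (fun i' hi' =>
    (hmono.monotone (Nat.add_le_add_left (Nat.lt_succ_iff.1 hi') _)).trans_lt hJ1) with
    ⟨_, hload⟩ | ⟨_, D, hD, h1, h2⟩
  · obtain ⟨D, hD⟩ := exists_adversaryInvariant (alg := alg) (lam := lam) (A := A) hlmin hl
      (j₀ + i + 1)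
    rw [← add_assoc] at hload
    obtain ⟨hc1, hc2⟩ := hc _ hJ2
    have hcard : (D.card : ℝ) ≤ A.arrivals true (σ A (j₀ + i + 1)).now := by
      exact_mod_cast hD.card_le_arrivals
    have hposl : 0 < (σ A (j₀ + i + 1)).load lmin lmax := by linarith
    refine ⟨D, hD, ?_, hposl⟩
    -- Live to the end: the algorithm has at most all short arrivals, while the load is at least the
    -- time played, which exceeds `now - F - lmax`.
    calc lmin * (D.card : ℝ) ≤ lmin * A.arrivals true (σ A (j₀ + i + 1)).now := by gcongr
      _ ≤ c₁ * (σ A (j₀ + i + 1)).now := hfew _ (hFW.trans hJ2)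
      _ ≤ c₂ * ((σ A (j₀ + i + 1)).now - F - lmax) := hc2
      _ ≤ c₂ * (σ A (j₀ + i + 1)).load lmin lmax := by
        gcongr
        linarith
      _ ≤ _ := by
        gcongr
        exact le_max_left _ _
  · exact ⟨D, hD, h1.trans (mul_le_mul_of_nonneg_right (le_max_right _ _) h2.le), h2⟩

theorem throughputAt_le_of_jam (hlmin : 0 < lmin) (hl : lmin < lmax) {c : ℝ} (hc : 0 ≤ c) {n : ℕ}
    {t : ℝ} {live : Prop} (h : RatioLE alg lmin lmax lam A c n) (h1 : (σ A n).now ≤ t)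
    (h2 : t < (σ A (n + 1)).now) (hn : σ A (n + 1) = (σ A n).play (lmin / 2) 0 0 live) :
    throughputAt alg lmin lmax A (adversaryErrors alg lmin lmax lam A) t ≤
      ENNReal.ofReal (min c (⌊lmax / lmin⌋₊ / (lmax / lmin))) := by
  obtain ⟨D, hD, hr, hpos⟩ := h
  have hopt := load_le_optDelivered (alg := alg) (lam := lam) (A := A) hlmin hl n h1
  have hlmax := hlmin.trans hl
  have hdel : alg.delivered lmin lmax A (adversaryErrors alg lmin lmax lam A) t ≤
      ENNReal.ofReal (lmin * D.card) := by
    -- The set `D` is still the delivered set at the next error, beyond `t`, so every state up to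
    -- time `t` has delivered a subset of `D`.
    obtain ⟨N, hN⟩ := (hD.jam hlmin hl hn).reaches
    have hfin := finiteBelow_adversaryErrors (alg := alg) (lam := lam) (A := A) hlmin hl
    refine iSup₂_le fun k hk => ENNReal.ofReal_le_ofReal ?_
    have hkN : k ≤ N := by
      refine ((OnlineAlgorithm.strictMono_state (alg := alg) (A := A) hlmin hl.le
        hfin).lt_iff_lt.1 ?_).le
      simp only [hN]
      exact hk.trans_lt h2
    have hsub := OnlineAlgorithm.monotone_state (alg := alg) (lmin := lmin) (lmax := lmax)
      (A := A) hfin hkN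
    simp only [hN] at hsub
    calc _ = ∑ i ∈ (alg.state lmin lmax A (adversaryErrors alg lmin lmax lam A) k).2, lmin :=
          Finset.sum_congr rfl fun i hi =>
            ArrivalPattern.length_of_isShort (hD.isShort i (hsub hi))
      _ ≤ lmin * D.card := by
        rw [Finset.sum_const, nsmul_eq_mul, mul_comm]
        gcongr
  have hne : optDelivered lmin lmax A (adversaryErrors alg lmin lmax lam A) t ≠ 0 := fun h0 => by
    rw [h0, nonpos_iff_eq_zero, ENNReal.ofReal_eq_zero] at hopt
    exact absurd hpos (not_lt.2 hopt)
  rw [throughputAt, if_neg fun h => hne h.2]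
  refine ENNReal.div_le_of_le_mul (hdel.trans ?_)
  have hG : 0 ≤ (⌊lmax / lmin⌋₊ : ℝ) / (lmax / lmin) := by positivity
  calc ENNReal.ofReal (lmin * D.card) ≤ ENNReal.ofReal
        (min c (⌊lmax / lmin⌋₊ / (lmax / lmin)) * (σ A n).load lmin lmax) := by
        refine ENNReal.ofReal_le_ofReal ?_
        rcases min_cases c (⌊lmax / lmin⌋₊ / (lmax / lmin)) with ⟨h, _⟩ | ⟨h, _⟩ <;> rw [h]
        · exact hr
        · refine (hD.mul_card_le hlmin hl).trans ?_
          gcongr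
          rw [AdversaryState.load]
          have : 0 ≤ lmin * ((σ A n).shorts : ℝ) := by positivity
          linarith
    _ = ENNReal.ofReal (min c (⌊lmax / lmin⌋₊ / (lmax / lmin))) *
        ENNReal.ofReal ((σ A n).load lmin lmax) :=
      ENNReal.ofReal_mul (le_min hc hG)
    _ ≤ _ := by gcongr

/-- After an active window the throughput remains small until the next active window. -/
theorem throughputAt_le_after_window (hlmin : 0 < lmin) (hl : lmin < lmax) {c : ℝ} (hc : 0 ≤ c)
    {n j : ℕ} (hj : (n * n.factorial : ℝ) ≤ (σ A j).now)
    (h : RatioLE alg lmin lmax lam A c j) {t : ℝ} (ht : (σ A j).now ≤ t)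
    (hnext : ∀ m, n < m → WindowActive (A.seed lam) m → t < m.factorial) :
    throughputAt alg lmin lmax A (adversaryErrors alg lmin lmax lam A) t ≤
      ENNReal.ofReal (min c (⌊lmax / lmin⌋₊ / (lmax / lmin))) := by
  have hmono := strictMono_adversary_now (alg := alg) (lam := lam) (A := A) hlmin hl
  -- Windows up to `n` are over, and by `hnext` no later active one has begun by time `t`.
  have hjam : ∀ k, j ≤ k → (σ A k).now ≤ t →
      σ A (k + 1) = (σ A k).play (lmin / 2) 0 0 True := fun k hk hkt => by
    have hnot : ¬ InWindow (A.seed lam) (σ A k).now := by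
      rintro ⟨m, hm, hm1, hm2⟩
      rcases le_or_gt m n with hmn | hmn
      · have h1 := mul_factorial_mono hmn
        have h2 : (σ A j).now ≤ (σ A k).now := hmono.monotone hk
        linarith
      · have := hnext m hmn hm
        linarith
    rcases adversary_succ_cases (alg := alg) (lam := lam) (A := A) hlmin hl k with
      ⟨_, h⟩ | ⟨hw, _⟩ | ⟨hw, _⟩ | ⟨hw, _⟩
    · exact h
    · exact absurd hw hnot
    · exact absurd hw hnot
    · exact absurd hw hnot
  have hratio : ∀ k, j ≤ k → (σ A k).now ≤ t → RatioLE alg lmin lmax lam A c k := by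
    intro k hk
    induction k, hk using Nat.le_induction with
    | base => exact fun _ => h
    | succ k hk ih =>
      intro hkt
      have hkt' := (hmono.monotone k.le_succ).trans hkt
      exact (ih hkt').jam hlmin hl (hjam k hk hkt')
  have hex : ∃ K, t < (σ A K).now :=
    ((tendsto_adversary_now (alg := alg) (lam := lam) (A := A) hlmin hl).eventually_gt_atTop
      t).exists
  classical
  have hjK : j < Nat.find hex := by
    by_contra hcon
    have := (Nat.find_spec hex).trans_le (hmono.monotone (not_lt.1 hcon))
    exact absurd this (not_lt.2 ht)
  obtain ⟨K, hK⟩ := Nat.exists_eq_succ_of_ne_zero (Nat.ne_zero_of_lt hjK)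
  have hK1 : (σ A K).now ≤ t := not_lt.1 (Nat.find_min hex (hK ▸ K.lt_succ_self))
  have hK2 : t < (σ A (K + 1)).now := by
    have := Nat.find_spec hex
    rwa [hK] at this
  have hjK' : j ≤ K := by omega
  exact throughputAt_le_of_jam hlmin hl hc (hratio K hjK' hK1) hK1 hK2 (hjam K hjK' hK1)

end

/-! ### The exponential law and the uniform seed. -/

section Exponential

variable {Ω : Type*} [MeasurableSpace Ω] {μ : Measure Ω} {lam : ℝ} {U : Ω → ℝ}

theorem expMeasure_Ioi (hlam : 0 < lam) {x : ℝ} (hx : 0 ≤ x) :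
    expMeasure lam (Set.Ioi x) = ENNReal.ofReal (Real.exp (-(lam * x))) := by
  have := isProbabilityMeasure_expMeasure hlam
  rw [← Set.compl_Iic, prob_compl_eq_one_sub measurableSet_Iic, ← ofReal_cdf,
    cdf_expMeasure_eq hlam, if_pos hx, ← ENNReal.ofReal_one, ← ENNReal.ofReal_sub]
  · congr 1
    ring
  · rw [sub_nonneg, Real.exp_le_one_iff, neg_nonpos]
    positivity

/-- By the layer-cake formula the mean is the integral of the tail `exp (-lam * t)`. -/
theorem lintegral_expMeasure (hlam : 0 < lam) (hU : Measurable U) (hpos : ∀ ω, 0 ≤ U ω)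
    (hlaw : μ.map U = expMeasure lam) : ∫⁻ ω, ENNReal.ofReal (U ω) ∂μ = ENNReal.ofReal lam⁻¹ := by
  rw [lintegral_eq_lintegral_meas_lt μ (ae_of_all _ hpos) hU.aemeasurable]
  have h1 : ∫⁻ t in Set.Ioi 0, μ {ω | t < U ω} =
      ∫⁻ t in Set.Ioi (0 : ℝ), ENNReal.ofReal (Real.exp (-lam * t)) := by
    refine setLIntegral_congr_fun measurableSet_Ioi fun t ht => ?_
    rw [neg_mul, ← expMeasure_Ioi hlam (le_of_lt ht), ← hlaw, Measure.map_apply hU measurableSet_Ioi]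
    rfl
  rw [h1, ← ofReal_integral_eq_lintegral_ofReal (exp_neg_integrableOn_Ioi 0 hlam)
    (ae_of_all _ fun _ => (Real.exp_pos _).le), integral_exp_mul_Ioi (neg_lt_zero.2 hlam)]
  congr 1
  simp

theorem integrable_of_map_eq_expMeasure (hlam : 0 < lam) (hU : Measurable U)
    (hpos : ∀ ω, 0 ≤ U ω) (hlaw : μ.map U = expMeasure lam) : Integrable U μ := by
  refine ⟨hU.aestronglyMeasurable, ?_⟩
  rw [hasFiniteIntegral_iff_ofReal (ae_of_all _ hpos), lintegral_expMeasure hlam hU hpos hlaw]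
  exact ENNReal.ofReal_lt_top

theorem integral_of_map_eq_expMeasure (hlam : 0 < lam) (hU : Measurable U)
    (hpos : ∀ ω, 0 ≤ U ω) (hlaw : μ.map U = expMeasure lam) : ∫ ω, U ω ∂μ = lam⁻¹ := by
  rw [integral_eq_lintegral_of_nonneg_ae (ae_of_all _ hpos) hU.aestronglyMeasurable,
    lintegral_expMeasure hlam hU hpos hlaw, ENNReal.toReal_ofReal (by positivity)]

/-- The exponential transform of an exponential random variable is uniform. -/
theorem measure_exp_neg_lt (hlam : 0 < lam) (hU : Measurable U)
    (hlaw : μ.map U = expMeasure lam) {b : ℝ} (hb : 0 ≤ b) (hb1 : b ≤ 1) :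
    μ {ω | Real.exp (-(lam * U ω)) < b} = ENNReal.ofReal b := by
  rcases hb.eq_or_lt with rfl | hb
  · simp [not_lt.2 (Real.exp_pos _).le]
  have h1 : {ω | Real.exp (-(lam * U ω)) < b} = U ⁻¹' Set.Ioi (-Real.log b / lam) := by
    ext ω
    simp only [Set.mem_ofPred_eq, Set.mem_preimage, Set.mem_Ioi]
    rw [← Real.lt_log_iff_exp_lt hb, div_lt_iff₀ hlam]
    constructor <;> intro h <;> linarith
  rw [h1, ← Measure.map_apply hU measurableSet_Ioi, hlaw, expMeasure_Ioi hlam]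
  · congr 1
    rw [mul_div_cancel₀ _ hlam.ne', neg_neg, Real.exp_log hb]
  · have := Real.log_nonpos hb.le hb1
    exact div_nonneg (by linarith) hlam.le

theorem measure_exp_neg_mem_Ico [IsProbabilityMeasure μ] (hlam : 0 < lam) (hU : Measurable U)
    (hpos : ∀ ω, 0 ≤ U ω) (hlaw : μ.map U = expMeasure lam) {a h : ℝ} (ha : 0 ≤ a) (hh : 0 ≤ h) :
    μ {ω | a ≤ Real.exp (-(lam * U ω)) ∧ Real.exp (-(lam * U ω)) < a + h} ≤
      ENNReal.ofReal h := by
  have hmeas : ∀ b, MeasurableSet {ω | Real.exp (-(lam * U ω)) < b} := fun b =>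
    measurableSet_lt (by fun_prop) measurable_const
  have hle : ∀ ω, Real.exp (-(lam * U ω)) ≤ 1 := fun ω => by
    rw [Real.exp_le_one_iff, neg_nonpos]
    exact mul_nonneg hlam.le (hpos ω)
  rcases le_or_gt a 1 with ha1 | ha1
  · have hsub : {ω | a ≤ Real.exp (-(lam * U ω)) ∧ Real.exp (-(lam * U ω)) < a + h} =
        {ω | Real.exp (-(lam * U ω)) < a + h} \ {ω | Real.exp (-(lam * U ω)) < a} := by
      ext ω
      simp only [Set.mem_ofPred_eq, Set.mem_sdiff, not_lt]
      exact and_comm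
    have hss : {ω | Real.exp (-(lam * U ω)) < a} ⊆ {ω | Real.exp (-(lam * U ω)) < a + h} :=
      fun ω hω => by
        simp only [Set.mem_ofPred_eq] at hω ⊢
        linarith
    rw [hsub, measure_sdiff hss
      (hmeas a).nullMeasurableSet (measure_ne_top _ _), measure_exp_neg_lt hlam hU hlaw ha ha1]
    rcases le_or_gt (a + h) 1 with hah | hah
    · rw [measure_exp_neg_lt hlam hU hlaw (by positivity) hah, ← ENNReal.ofReal_sub _ ha]
      exact ENNReal.ofReal_le_ofReal (by linarith)
    · refine (tsub_le_tsub_right prob_le_one _).trans ?_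
      rw [← ENNReal.ofReal_one, ← ENNReal.ofReal_sub _ ha]
      exact ENNReal.ofReal_le_ofReal (by linarith)
  · have : {ω | a ≤ Real.exp (-(lam * U ω)) ∧ Real.exp (-(lam * U ω)) < a + h} = ∅ := by
      ext ω
      simp only [Set.mem_ofPred_eq, Set.mem_empty_iff_false, iff_false, not_and]
      intro h1
      linarith [hle ω]
    simp [this]

end Exponential

/-! ### Rarity of active windows. -/

theorem measurableSet_windowActive (n : ℕ) : MeasurableSet {v | WindowActive v n} := by
  have : {v | WindowActive v n} = ⋃ k : ℕ, {v : ℝ | n = k * k + ⌊k * v⌋₊} := by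
    ext v
    simp [WindowActive]
  rw [this]
  refine MeasurableSet.iUnion fun k => ?_
  have hf : Measurable fun v : ℝ => k * k + ⌊k * v⌋₊ :=
    measurable_const.add (Nat.measurable_floor.comp (measurable_const.mul measurable_id))
  have := hf (measurableSet_singleton n)
  convert this using 1
  ext v
  simp [eq_comm]

/-- The blocks `[k², k² + k]` are disjoint, so `n` determines `k = n.sqrt` and `⌊k * v⌋₊`, which
confines `v` to an interval of length `1 / k`. -/
theorem WindowActive.mem_Ico {v : ℝ} {n : ℕ} (h : WindowActive v n) (hn : 0 < n) (hv : 0 ≤ v)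
    (hv1 : v ≤ 1) : ((n - n.sqrt * n.sqrt : ℕ) : ℝ) / n.sqrt ≤ v ∧
      v < ((n - n.sqrt * n.sqrt : ℕ) : ℝ) / n.sqrt + 1 / n.sqrt := by
  obtain ⟨k, hk⟩ := h
  have hfl : ⌊k * v⌋₊ ≤ k := Nat.floor_le_of_le (mul_le_of_le_one_right k.cast_nonneg hv1)
  have hsq : n.sqrt = k := by
    rw [hk]
    exact Nat.sqrt_add_eq k (by omega)
  have hk0 : (0 : ℝ) < k := by
    rw [← hsq]
    exact_mod_cast Nat.sqrt_pos.2 hn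
  have hsub : n - k * k = ⌊k * v⌋₊ := by omega
  rw [hsq, hsub, ← add_div, div_le_iff₀ hk0, lt_div_iff₀ hk0, mul_comm v]
  exact ⟨Nat.floor_le (by positivity), Nat.lt_floor_add_one _⟩

section

variable {Ω : Type*} [MeasurableSpace Ω] {μ : Measure Ω} {lam p : ℝ} {A : Ω → ArrivalPattern}

theorem ArrivalPattern.gap_pos (A : ArrivalPattern) (n : ℕ) : 0 < A.gap n := by
  cases n with
  | zero => exact A.time_pos 0
  | succ n => exact sub_pos.2 (A.time_strictMono n.lt_succ_self)

theorem ArrivalPattern.sum_gap (A : ArrivalPattern) (n : ℕ) :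
    ∑ i ∈ Finset.range (n + 1), A.gap i = A.time n := by
  induction n with
  | zero => simp [gap]
  | succ n ih =>
    rw [Finset.sum_range_succ, ih, gap]
    ring

namespace IsPoissonArrivals

theorem measurable_time (hA : IsPoissonArrivals μ lam p A) (n : ℕ) :
    Measurable fun ω => (A ω).time n := by
  simp only [← ArrivalPattern.sum_gap]
  exact Finset.measurable_sum _ fun i _ => hA.measurable_gap i

theorem measurable_seed (hA : IsPoissonArrivals μ lam p A) :
    Measurable fun ω => (A ω).seed lam := by
  have := hA.measurable_time 0
  unfold ArrivalPattern.seed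
  fun_prop

/-- It is unlikely that a given late window is active. -/
theorem tendsto_measure_windowActive [IsProbabilityMeasure μ] (hA : IsPoissonArrivals μ lam p A)
    (hlam : 0 < lam) :
    Tendsto (fun n => μ {ω | WindowActive ((A ω).seed lam) n}) atTop (nhds 0) := by
  have hlim : Tendsto (fun n : ℕ => ENNReal.ofReal (1 / n.sqrt)) atTop (nhds 0) := by
    rw [← ENNReal.ofReal_zero]
    refine ENNReal.tendsto_ofReal (tendsto_one_div_atTop_nhds_zero_nat.comp ?_)
    refine tendsto_atTop_atTop.2 fun b => ⟨b * b, fun a ha => Nat.le_sqrt.2 ha⟩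
  refine tendsto_of_tendsto_of_tendsto_of_le_of_le' tendsto_const_nhds hlim
    (Eventually.of_forall fun _ => zero_le) ?_
  filter_upwards [eventually_gt_atTop 0] with n hn
  refine (measure_mono fun ω hω => ?_).trans (measure_exp_neg_mem_Ico hlam (hA.measurable_gap 0)
    (fun ω => ((A ω).gap_pos 0).le) (hA.gap_law 0)
    (a := ((n - n.sqrt * n.sqrt : ℕ) : ℝ) / n.sqrt) (h := 1 / n.sqrt) (by positivity)
    (by positivity))
  exact WindowActive.mem_Ico hω hn ((A ω).seed_pos lam).le ((A ω).seed_lt_one hlam).le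

end IsPoissonArrivals

/-- An almost sure eventual property holds uniformly outside a small measurable set. -/
theorem exists_measurableSet_forall_ge [IsFiniteMeasure μ] {P : ℕ → Ω → Prop}
    (hP : ∀ n, MeasurableSet {ω | P n ω}) (h : ∀ᵐ ω ∂μ, ∀ᶠ n in atTop, P n ω) {δ : ℝ≥0∞}
    (hδ : 0 < δ) : ∃ Z, MeasurableSet Z ∧ μ Z < δ ∧ ∃ N, ∀ ω ∉ Z, ∀ n ≥ N, P n ω := by
  set Z : ℕ → Set Ω := fun N => ⋃ n, ⋃ (_ : N ≤ n), {ω | P n ω}ᶜ with hZ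
  have hmem : ∀ N ω, ω ∈ Z N ↔ ∃ n, N ≤ n ∧ ¬ P n ω := fun N ω => by simp [hZ]
  have hmeas : ∀ N, MeasurableSet (Z N) := fun N =>
    MeasurableSet.iUnion fun n => MeasurableSet.iUnion fun _ => (hP n).compl
  have hanti : Antitone Z := fun M N hMN ω hω => by
    rw [hmem] at hω ⊢
    obtain ⟨n, h1, h2⟩ := hω
    exact ⟨n, hMN.trans h1, h2⟩
  have hnull : μ (⋂ N, Z N) = 0 := by
    refine measure_mono_null (fun ω hω => ?_) (ae_iff.1 h)
    simp only [Set.mem_iInter, hmem] at hω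
    simp only [Set.mem_ofPred_eq, eventually_atTop, not_exists, not_forall]
    intro N
    obtain ⟨n, h1, h2⟩ := hω N
    exact ⟨n, h1, h2⟩
  -- The bad sets decrease to a null set, so continuity from above makes one of them small.
  have hlim := tendsto_measure_iInter_atTop (μ := μ) (fun N => (hmeas N).nullMeasurableSet) hanti
    ⟨0, measure_ne_top _ _⟩
  rw [hnull] at hlim
  obtain ⟨N, hN⟩ := (hlim.eventually_lt_const hδ).exists
  refine ⟨Z N, hmeas N, hN, N, fun ω hω n hn => ?_⟩
  by_contra hcon
  exact hω ((hmem N ω).2 ⟨n, hn, hcon⟩)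

/-! ### Laws of large numbers for the arrivals. -/

namespace ArrivalPattern

/-- The number of short packets among the first `n` packets. -/
def shortCount (A : ArrivalPattern) (n : ℕ) : ℕ :=
  ((Finset.range n).filter fun i => A.isShort i = true).card

theorem exists_time_le_lt (A : ArrivalPattern) {t : ℝ} (ht : A.time 0 ≤ t) :
    ∃ m, A.time m ≤ t ∧ t < A.time (m + 1) := by
  classical
  have hex : ∃ k, t < A.time k := (A.time_unbounded.eventually_gt_atTop t).exists
  have h0 : Nat.find hex ≠ 0 := fun h => by
    have := Nat.find_spec hex
    rw [h] at this
    exact absurd this (not_lt.2 ht)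
  obtain ⟨m, hm⟩ := Nat.exists_eq_succ_of_ne_zero h0
  refine ⟨m, not_lt.1 (Nat.find_min hex (hm ▸ m.lt_succ_self)), ?_⟩
  have := Nat.find_spec hex
  rwa [hm] at this

theorem arrivals_eq_card (A : ArrivalPattern) (b : Bool) {t : ℝ} {m : ℕ} (h1 : A.time m ≤ t)
    (h2 : t < A.time (m + 1)) :
    A.arrivals b t = ((Finset.range (m + 1)).filter fun i => A.isShort i = b).card := by
  rw [← Set.ncard_coe_finset]
  unfold arrivals
  congr 1
  ext n
  simp only [Set.mem_ofPred_eq, Finset.coe_filter, Finset.mem_range]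
  refine and_congr_left fun _ => ⟨fun h => A.time_strictMono.lt_iff_lt.1 (h.trans_lt h2),
    fun h => (A.time_strictMono.monotone (Nat.lt_succ_iff.1 h)).trans h1⟩

theorem shortCount_add (A : ArrivalPattern) (n : ℕ) :
    A.shortCount n + ((Finset.range n).filter fun i => A.isShort i = false).card = n := by
  have := Finset.card_filter_add_card_filter_not (s := Finset.range n)
    (fun i => A.isShort i = true)
  simpa [shortCount] using this

end ArrivalPattern

namespace IsPoissonArrivals

theorem measurable_shortCount (hA : IsPoissonArrivals μ lam p A) (n : ℕ) :
    Measurable fun ω => (A ω).shortCount n := by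
  simp only [ArrivalPattern.shortCount, Finset.card_filter]
  exact Finset.measurable_sum _ fun i _ =>
    Measurable.ite (hA.measurable_isShort i (measurableSet_singleton true)) measurable_const
      measurable_const

theorem ae_tendsto_time_div (hA : IsPoissonArrivals μ lam p A) (hlam : 0 < lam) :
    ∀ᵐ ω ∂μ, Tendsto (fun n : ℕ => (A ω).time n / (n + 1 : ℕ)) atTop (nhds lam⁻¹) := by
  have hpos : ∀ ω, 0 ≤ (A ω).gap 0 := fun ω => ((A ω).gap_pos 0).le
  have hslln := strong_law_ae_real (μ := μ) (fun n ω => (A ω).gap n)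
    (integrable_of_map_eq_expMeasure hlam (hA.measurable_gap 0) hpos (hA.gap_law 0))
    (fun i j hij => (hA.indep.indepFun hij).comp measurable_fst measurable_fst)
    (fun i => ⟨(hA.measurable_gap i).aemeasurable, (hA.measurable_gap 0).aemeasurable,
      (hA.gap_law i).trans (hA.gap_law 0).symm⟩)
  filter_upwards [hslln] with ω hω
  rw [integral_of_map_eq_expMeasure hlam (hA.measurable_gap 0) hpos (hA.gap_law 0)] at hω
  simpa only [ArrivalPattern.sum_gap] using (tendsto_add_atTop_iff_nat 1).2 hω

theorem ae_tendsto_shortCount_div [IsProbabilityMeasure μ] (hA : IsPoissonArrivals μ lam p A)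
    (hp : 0 ≤ p) :
    ∀ᵐ ω ∂μ, Tendsto (fun n : ℕ => ((A ω).shortCount n : ℝ) / n) atTop (nhds p) := by
  set f : Bool → ℝ := fun b => if b = true then 1 else 0 with hf
  have hfm : Measurable f := measurable_of_finite f
  have hmeas : ∀ n, Measurable fun ω => f ((A ω).isShort n) :=
    fun n => hfm.comp (hA.measurable_isShort n)
  have hset : MeasurableSet {ω | (A ω).isShort 0 = true} :=
    hA.measurable_isShort 0 (measurableSet_singleton true)
  have hind : (fun ω => f ((A ω).isShort 0)) =
      {ω | (A ω).isShort 0 = true}.indicator fun _ => (1 : ℝ) := by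
    ext ω
    simp [hf, Set.indicator_apply]
  have hident : ∀ n, IdentDistrib (fun ω => (A ω).isShort n) (fun ω => (A ω).isShort 0) μ μ := by
    intro n
    refine ⟨(hA.measurable_isShort n).aemeasurable, (hA.measurable_isShort 0).aemeasurable, ?_⟩
    have htrue : ∀ n, μ.map (fun ω => (A ω).isShort n) {true} = ENNReal.ofReal p := fun n => by
      rw [Measure.map_apply (hA.measurable_isShort n) (measurableSet_singleton _)]
      exact hA.short_prob n
    have hfalse : ∀ n, μ.map (fun ω => (A ω).isShort n) {false} = 1 - ENNReal.ofReal p := fun n => by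
      have := Measure.isProbabilityMeasure_map (μ := μ) (hA.measurable_isShort n).aemeasurable
      rw [← htrue n, ← prob_compl_eq_one_sub (measurableSet_singleton _)]
      congr 1
      ext b
      cases b <;> simp
    refine Measure.ext_of_singleton fun b => ?_
    cases b
    · rw [hfalse, hfalse]
    · rw [htrue, htrue]
  have hint : Integrable (fun ω => f ((A ω).isShort 0)) μ := by
    rw [hind]
    exact (integrable_const 1).indicator hset
  have hslln := strong_law_ae_real (μ := μ) (fun n ω => f ((A ω).isShort n)) hint
    (fun i j hij => (hA.indep.indepFun hij).comp (hfm.comp measurable_snd)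
      (hfm.comp measurable_snd))
    (fun i => (hident i).comp hfm)
  have hmean : ∫ ω, f ((A ω).isShort 0) ∂μ = p := by
    rw [hind, integral_indicator_const _ hset, measureReal_def, hA.short_prob 0,
      ENNReal.toReal_ofReal hp]
    simp
  filter_upwards [hslln] with ω hω
  rw [hmean] at hω
  refine hω.congr fun n => ?_
  rw [ArrivalPattern.shortCount, Finset.card_filter]
  push_cast
  rfl

/-- Outside a small set, from some time on, the short packets arrive at a rate of at most
`lam * p + ε`, and the majority of the packets is long. -/
theorem exists_measurableSet_regular [IsProbabilityMeasure μ] (hA : IsPoissonArrivals μ lam p A)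
    (hlam : 0 < lam) (hp : 0 < p) (hp2 : p < 1 / 2) {ε : ℝ} (hε : 0 < ε) {δ : ℝ≥0∞}
    (hδ : 0 < δ) :
    ∃ Z, MeasurableSet Z ∧ μ Z < δ ∧ ∃ T : ℝ, ∀ ω ∉ Z, (A ω).time 0 ≤ T ∧ ∀ t ≥ T,
      ((A ω).arrivals true t : ℝ) ≤ (lam * p + ε) * t ∧
      (A ω).arrivals true t < (A ω).arrivals false t ∧ 0 < (A ω).arrivals true t := by
  have hS := hA.measurable_shortCount
  have ht := hA.measurable_time
  have hSr : ∀ n, Measurable fun ω => ((A ω).shortCount n : ℝ) :=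
    fun n => measurable_from_top.comp (hS n)
  obtain ⟨Z, hZ, hZδ, N, hN⟩ := exists_measurableSet_forall_ge (μ := μ)
    -- The last clause bounds the arrival times uniformly in `ω`, so that the threshold `T` can be
    -- chosen independently of `ω`.
    (P := fun n ω => ((A ω).shortCount (n + 1) : ℝ) ≤ (lam * p + ε) * (A ω).time n ∧
      (2 * (A ω).shortCount (n + 1) : ℝ) < (n + 1 : ℕ) ∧ (0 : ℝ) < (A ω).shortCount (n + 1) ∧
      (A ω).time n ≤ (lam⁻¹ + 1) * (n + 1 : ℕ))
    (fun n => (measurableSet_le (hSr _) ((ht n).const_mul _)).inter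
      ((measurableSet_lt ((hSr _).const_mul 2) measurable_const).inter
        ((measurableSet_lt measurable_const (hSr _)).inter
          (measurableSet_le (ht n) measurable_const)))) (by
      filter_upwards [hA.ae_tendsto_time_div hlam, hA.ae_tendsto_shortCount_div hp.le]
        with ω h1 h2
      -- Packet `n` is the `(n + 1)`-st. Dividing the limit `p` of the short fraction by the limit
      -- `lam⁻¹` of the time per packet gives the short rate `lam * p`.
      have h2' := (tendsto_add_atTop_iff_nat 1).2 h2
      have h3 := h2'.div h1 (by positivity)
      rw [div_inv_eq_mul, mul_comm] at h3
      filter_upwards [h3.eventually_lt_const (lt_add_of_pos_right _ hε),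
        h2'.eventually_lt_const hp2, h2'.eventually_const_lt hp,
        h1.eventually_lt_const (lt_add_one _)] with n g1 g2 g3 g4
      have hn : (0 : ℝ) < (n + 1 : ℕ) := by positivity
      have htn : 0 < (A ω).time n := (A ω).time_pos n
      rw [Pi.div_apply, div_div_div_cancel_right₀ hn.ne', div_lt_iff₀ htn] at g1
      rw [div_lt_iff₀ hn] at g2 g4
      rw [lt_div_iff₀ hn, zero_mul] at g3
      exact ⟨g1.le, by linarith, g3, g4.le⟩) hδ
  refine ⟨Z, hZ, hZδ, (lam⁻¹ + 1) * (N + 1 : ℕ), fun ω hω => ?_⟩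
  have hT : (A ω).time N ≤ (lam⁻¹ + 1) * (N + 1 : ℕ) := (hN ω hω N le_rfl).2.2.2
  have h0 : (A ω).time 0 ≤ (lam⁻¹ + 1) * (N + 1 : ℕ) :=
    ((A ω).time_strictMono.monotone N.zero_le).trans hT
  refine ⟨h0, fun t htT => ?_⟩
  obtain ⟨m, hm1, hm2⟩ := (A ω).exists_time_le_lt (h0.trans htT)
  have hNm : N ≤ m := Nat.lt_succ_iff.1
    ((A ω).time_strictMono.lt_iff_lt.1 ((hT.trans htT).trans_lt hm2))
  obtain ⟨g1, g2, g3, _⟩ := hN ω hω m hNm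
  have hsum := (A ω).shortCount_add (m + 1)
  rw [(A ω).arrivals_eq_card true hm1 hm2, (A ω).arrivals_eq_card false hm1 hm2]
  rw [← ArrivalPattern.shortCount]
  have g2' : 2 * (A ω).shortCount (m + 1) < m + 1 := by exact_mod_cast g2
  refine ⟨g1.trans ?_, by omega, by exact_mod_cast g3⟩
  have : 0 ≤ lam * p + ε := by positivity
  gcongr

end IsPoissonArrivals

end

/-! ### From regular arrivals to the expected throughput. -/

/-- For regular arrivals the throughput is small outside the active windows. -/
theorem exists_throughputAt_le_of_regular (alg : OnlineAlgorithm) {lmin lmax lam c₁ c₂ : ℝ}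
    (hlmin : 0 < lmin) (hl : lmin < lmax) (hlam : 0 < lam) (hc₁ : 0 ≤ c₁) (hc : c₁ < c₂) (T : ℝ) :
    ∃ N₀, ∀ A : ArrivalPattern, A.time 0 ≤ T →
      (∀ t ≥ T, lmin * A.arrivals true t ≤ c₁ * t ∧ A.arrivals true t < A.arrivals false t ∧
        0 < A.arrivals true t) →
      ∀ N ≥ N₀, ¬ WindowActive (A.seed lam) N → ∀ t : ℝ, (N.factorial : ℝ) ≤ t →
        t < (N + 1).factorial →
        throughputAt alg lmin lmax A (adversaryErrors alg lmin lmax lam A) t ≤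
          ENNReal.ofReal (min (max c₂ (⌊lmax / lmin⌋₊ / (lmax / lmin + ⌊lmax / lmin⌋₊)))
            (⌊lmax / lmin⌋₊ / (lmax / lmin))) := by
  have hlmax := hlmin.trans hl
  -- Write `F` for the start of the window and `m` for its index. The constant `3` gives `F + lmax ≤
  -- 2 * F < m * F`, and `m ≥ 2 * c₂ / (c₂ - c₁)` gives `c₁ * t ≤ c₂ * (t - F - lmax)` for `t ≥ m *
  -- F`.
  obtain ⟨M, hM⟩ := ((eventually_factorial_ge lmax).and ((eventually_factorial_ge (T + 1)).and
    ((eventually_ge_atTop 3).and (tendsto_natCast_atTop_atTop.eventually_ge_atTop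
      (2 * c₂ / (c₂ - c₁)))))).exists_forall_of_atTop
  refine ⟨(M + 1) * (M + 1) + (M + 1), fun A h0 hreg N hN hact t ht1 ht2 => ?_⟩
  classical
  obtain ⟨k, hk1, hk2, hk3⟩ := exists_windowActive (A.seed_lt_one hlam).le (M + 1)
  have hkN : k ≤ N := hk2.trans hN
  -- The last active window up to `N` lies strictly before `N`, as `N` is inactive, and determines
  -- the ratio up to time `(N + 1)!`.
  have hn1 : WindowActive (A.seed lam) (Nat.findGreatest (WindowActive (A.seed lam)) N) :=
    Nat.findGreatest_spec hkN hk3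
  have hn2 : k ≤ Nat.findGreatest (WindowActive (A.seed lam)) N := Nat.le_findGreatest hkN hk3
  have hn3 : Nat.findGreatest (WindowActive (A.seed lam)) N ≤ N := Nat.findGreatest_le N
  have hn4 : ∀ m, Nat.findGreatest (WindowActive (A.seed lam)) N < m →
      WindowActive (A.seed lam) m → N < m := fun m hm hm' => by
    by_contra hcon
    exact absurd (Nat.le_findGreatest (not_lt.1 hcon) hm') (not_le.2 hm)
  generalize Nat.findGreatest (WindowActive (A.seed lam)) N = n at hn1 hn2 hn3 hn4
  have hnN : n < N := lt_of_le_of_ne hn3 (by rintro rfl; exact hact hn1)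
  obtain ⟨n, rfl⟩ : ∃ n', n = n' + 1 := ⟨n - 1, by omega⟩
  obtain ⟨g1, -, -, -⟩ := hM n (by omega)
  obtain ⟨g5, g2, g3, g4⟩ := hM (n + 1) (by omega)
  have hfac : (n.factorial : ℝ) ≤ (n + 1).factorial := by
    exact_mod_cast Nat.factorial_le n.le_succ
  have hF : (0 : ℝ) < (n + 1).factorial := by exact_mod_cast Nat.factorial_pos _
  have hTF : ∀ t, ((n + 1).factorial : ℝ) ≤ t → T ≤ t := fun t ht => by linarith
  have hn3' : (3 : ℝ) * (n + 1).factorial ≤ (n + 1 : ℕ) * (n + 1).factorial := by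
    gcongr
    exact_mod_cast g3
  obtain ⟨j, hj1, hj2, hj3⟩ := exists_ratioLE (alg := alg) (lam := lam) (A := A) (c₁ := c₁)
    (c₂ := c₂) hlmin hl g1 (by linarith) hn1 (fun t ht => (hreg t (hTF t ht)).1)
    (fun t ht => (hreg t (hTF t ht)).2.1) (fun t ht => (hreg t (hTF t ht)).2.2) (by linarith)
    (fun t ht => by
      refine ⟨by linarith, ?_⟩
      rw [div_le_iff₀ (by linarith)] at g4
      have h1 : c₂ * lmax ≤ c₂ * (n + 1).factorial := by
        have : 0 ≤ c₂ := by linarith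
        gcongr
      have h2 := mul_le_mul_of_nonneg_right g4 hF.le
      have h3 := mul_le_mul_of_nonneg_left ht (sub_nonneg.2 hc.le)
      linarith)
  have hsucc := succ_mul_factorial_add n
  have hle : ((n + 2).factorial : ℝ) ≤ N.factorial := by
    exact_mod_cast Nat.factorial_le hnN
  have hmax : 0 ≤ max c₂ (⌊lmax / lmin⌋₊ / (lmax / lmin + ⌊lmax / lmin⌋₊) : ℝ) :=
    le_max_of_le_left (by linarith)
  refine throughputAt_le_after_window hlmin hl hmax hj1 hj3 (by linarith) fun m hm hm' => ?_
  refine ht2.trans_le ?_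
  exact_mod_cast Nat.factorial_le (hn4 m hm hm')

theorem exists_factorial_le_lt {t : ℝ} {K : ℕ} (ht : (K.factorial : ℝ) ≤ t) :
    ∃ N, K ≤ N ∧ (N.factorial : ℝ) ≤ t ∧ t < (N + 1).factorial := by
  classical
  have hex : ∃ N : ℕ, t < (N + 1).factorial := by
    obtain ⟨N, hN⟩ := ((eventually_factorial_ge (t + 1)).and (eventually_ge_atTop 1)).exists
    refine ⟨N, (lt_add_one t).trans_le (hN.1.trans ?_)⟩
    exact_mod_cast Nat.factorial_le N.le_succ
  have hK : ∀ N : ℕ, t < (N + 1).factorial → K ≤ N := fun N hN => by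
    by_contra hcon
    have : ((N + 1).factorial : ℝ) ≤ K.factorial := by
      exact_mod_cast Nat.factorial_le (not_le.1 hcon)
    linarith
  refine ⟨Nat.find hex, hK _ (Nat.find_spec hex), ?_, Nat.find_spec hex⟩
  rcases Nat.eq_zero_or_pos (Nat.find hex) with h0 | hpos
  · have h1 := hK _ (Nat.find_spec hex)
    rw [h0, Nat.le_zero] at h1
    rwa [h0, ← h1]
  · have := Nat.find_min hex (Nat.sub_lt hpos one_pos)
    rwa [not_lt, show Nat.find hex - 1 + 1 = Nat.find hex by omega] at this

variable {Ω : Type*} [MeasurableSpace Ω]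

/-- The function `c + 1_Z` is a measurable majorant of `f`, whether or not `f` is measurable. -/
theorem upperExpectation_le_add {μ : Measure Ω} [IsProbabilityMeasure μ] {f : Ω → ℝ≥0∞}
    {c : ℝ≥0∞} {Z : Set Ω} (hZ : MeasurableSet Z) (h1 : ∀ ω, f ω ≤ 1) (hc : ∀ ω ∉ Z, f ω ≤ c) :
    upperExpectation μ f ≤ c + μ Z := by
  classical
  have hle : ∀ ω, f ω ≤ c + Z.indicator (fun _ => 1) ω := fun ω => by
    by_cases hω : ω ∈ Z
    · simpa [hω] using (h1 ω).trans le_add_self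
    · simpa [hω] using hc ω hω
  calc upperExpectation μ f ≤ ∫⁻ ω, c + Z.indicator (fun _ => 1) ω ∂μ :=
        iInf_le_of_le _ (iInf₂_le_of_le
          (measurable_const.add (measurable_const.indicator hZ)) hle le_rfl)
    _ = c + μ Z := by
      rw [lintegral_add_left measurable_const, lintegral_const, measure_univ, mul_one,
        lintegral_indicator_const hZ, one_mul]

theorem limsup_upperExpectation_le (μ : Measure Ω) [IsProbabilityMeasure μ]
    {lmin lmax lam p : ℝ} (hlmin : 0 < lmin) (hl : lmin < lmax) (hlam : 0 < lam) (hp : 0 < p)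
    (hp2 : p < 1 / 2) {A : Ω → ArrivalPattern} (hA : IsPoissonArrivals μ lam p A)
    (alg : OnlineAlgorithm) {ε : ℝ} (hε : 0 < ε) :
    limsup (fun t : ℝ => upperExpectation μ fun ω => throughputAt alg lmin lmax (A ω)
        (adversaryErrors alg lmin lmax lam (A ω)) t) atTop ≤
      ENNReal.ofReal (min (max (lam * p * lmin + ε)
        (⌊lmax / lmin⌋₊ / (lmax / lmin + ⌊lmax / lmin⌋₊)))
        (⌊lmax / lmin⌋₊ / (lmax / lmin))) + (ENNReal.ofReal ε + ENNReal.ofReal ε) := by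
  have hδ : 0 < ENNReal.ofReal ε := ENNReal.ofReal_pos.2 hε
  -- Multiplied by `lmin`, this error in the rate becomes `ε / 2`; the other half of `ε` is the
  -- slack between `c₁` and `c₂` needed to neglect the past of a window.
  obtain ⟨Z, hZ, hZδ, T, hT⟩ := hA.exists_measurableSet_regular hlam hp hp2
    (ε := ε / 2 / lmin) (by positivity) hδ
  obtain ⟨N₀, hN₀⟩ := exists_throughputAt_le_of_regular alg (lam := lam)
    (c₁ := lam * p * lmin + ε / 2) (c₂ := lam * p * lmin + ε) hlmin hl hlam (by positivity)
    (by linarith) T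
  obtain ⟨N₁, hN₁⟩ := ((hA.tendsto_measure_windowActive hlam).eventually_lt_const
    hδ).exists_forall_of_atTop
  refine limsup_le_of_le (by isBoundedDefault) ?_
  filter_upwards [eventually_ge_atTop (((max N₀ N₁).factorial : ℕ) : ℝ)] with t ht
  obtain ⟨N, hN, hN1, hN2⟩ := exists_factorial_le_lt ht
  have hact : MeasurableSet {ω | WindowActive ((A ω).seed lam) N} :=
    hA.measurable_seed (measurableSet_windowActive N)
  -- Two exceptional events, each of probability at most `ε`: irregular arrivals, and window `N`
  -- being active.
  refine (upperExpectation_le_add (hZ.union hact) (fun ω => throughputAt_le_one alg hlmin hl.le _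
    (finiteBelow_adversaryErrors hlmin hl) t) fun ω hω => ?_).trans
    (add_le_add_right ((measure_union_le _ _).trans
      (add_le_add hZδ.le (hN₁ N ((le_max_right _ _).trans hN)).le)) _)
  rw [Set.mem_union, not_or] at hω
  refine hN₀ (A ω) (hT ω hω.1).1 (fun s hs => ?_) N ((le_max_left _ _).trans hN) hω.2 t hN1 hN2
  obtain ⟨h1, h2⟩ := (hT ω hω.1).2 s hs
  refine ⟨?_, h2⟩
  calc lmin * ((A ω).arrivals true s : ℝ) ≤ lmin * ((lam * p + ε / 2 / lmin) * s) := by gcongr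
    _ = _ := by field_simp

end PacketScheduling

theorem mainTheorem4 {Ω : Type*} [MeasurableSpace Ω] (μ : MeasureTheory.Measure Ω)
    [MeasureTheory.IsProbabilityMeasure μ]
    (lmin lmax lam p q : ℝ) (hlmin : 0 < lmin) (hl : lmin < lmax) (hlam : 0 < lam)
    (hp : 0 < p) (hq : 0 < q) (hpq : p + q = 1) (hlt : p < q)
    (A : Ω → PacketScheduling.ArrivalPattern) (hA : PacketScheduling.IsPoissonArrivals μ lam p A)
    (alg : PacketScheduling.OnlineAlgorithm)
    (ρ γ : ℝ) (hρ : ρ = lmax / lmin) (hγ : γ = (⌊ρ⌋ : ℝ)) :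
    PacketScheduling.relativeThroughput lmin lmax μ A alg ≤
      ENNReal.ofReal (min (max (lam * p * lmin) (γ / (ρ + γ))) (γ / ρ)) := by
  have hlmax := hlmin.trans hl
  have hfloor : γ = (⌊lmax / lmin⌋₊ : ℝ) := by
    rw [hγ, hρ, natCast_floor_eq_intCast_floor (by positivity)]
  refine iInf_le_of_le
    (PacketScheduling.adversaryErrorFunction alg lmin lmax lam hlmin hl hlam) ?_
  refine ENNReal.le_of_forall_pos_le_add fun ε hε _ => ?_
  -- One third goes to the perturbed bound, and one to each of the two exceptional events.
  have hε3 : (0 : ℝ) < ε / 3 := by positivity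
  refine (PacketScheduling.limsup_upperExpectation_le μ hlmin hl hlam hp (by linarith) hA alg
    hε3).trans ?_
  rw [← hfloor, ← hρ, ← ENNReal.ofReal_coe_nnreal, ← ENNReal.ofReal_add hε3.le hε3.le]
  have hpos : 0 ≤ min (max (lam * p * lmin) (γ / (ρ + γ))) (γ / ρ) := by
    have : 0 ≤ γ := hfloor ▸ Nat.cast_nonneg _
    have : 0 ≤ ρ := by rw [hρ]; positivity
    exact le_min (le_max_of_le_left (by positivity)) (by positivity)
  have hle : min (max (lam * p * lmin + ε / 3) (γ / (ρ + γ))) (γ / ρ) ≤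
      min (max (lam * p * lmin) (γ / (ρ + γ))) (γ / ρ) + ε / 3 := by
    rw [min_add, max_add]
    exact min_le_min (max_le_max le_rfl (by linarith)) (by linarith)
  rw [← ENNReal.ofReal_add hpos ε.coe_nonneg]
  refine (add_le_add_left (ENNReal.ofReal_le_ofReal hle) _).trans ?_
  rw [← ENNReal.ofReal_add (by positivity) (by positivity)]
  exact ENNReal.ofReal_le_ofReal (by linarith)
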